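/- Let $B(d_1,\dots,d_n)$ ($n\ge1$, $d_i\in\mathbb{Z}_{\ge0}$) be the rational numbers determined by $B(0)=\tfrac18$ and, for every $d\ge0$, $n\ge0$ and $\mathbf d=(d_1,\dots,d_n)\in(\mathbb{Z}_{\ge0})^n$ with $(n,d)\neq(0,0)$, $$B(d,\mathbf d)=\sum_{i=1}^n(2d_i+1)\,B(d_1,\dots,d_i+d,\dots,d_n)+\frac12\sum_{\substack{a,b\ge0\\a+b=d-1}}\Bigl(B(a,b,\mathbf d)+\sum_{I\sqcup J=\{1,\dots,n\}}B(a,\mathbf d_I)\,B(b,\mathbf d_J)\Bigr),$$ so that $\langle\tau_{d_1}\cdots\tau_{d_n}\rangle^{\Theta}_{g}=B(\mathbf d)/\prod_{j=1}^n(2d_j+1)!!$, with $g=g(\mathbf d)=d_1+\cdots+d_n+1$, are the Brézin–Gross–Witten numbers. Put $X(\mathbf d)=\sum_{j=1}^n(2d_j+1)$ and $$C(\mathbf d)=\frac{2^{2g(\mathbf d)-1}\prod_{j=1}^n(2d_j+1)!!}{(X(\mathbf d)-1)!}\,\langle\tau_{d_1}\cdots\tau_{d_n}\rangle^{\Theta}_{g(\mathbf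 d)},\qquad \gamma(X)=\frac{\Gamma(\frac X2+1)^2}{\pi\,\Gamma(\frac{X+1}2)\,\Gamma(\frac{X+3}2)},\qquad \widehat C(\mathbf d)=\frac{C(\mathbf d)}{\gamma(X(\mathbf d))}.$$ There are polynomials $\widehat c_k\in\mathbb{Q}[p_1,p_2,\dots]$ ($k\ge0$), in variables $p_b$ ($b\ge1$), such that: 1. for every $n\ge1$ and every fixed $\mathbf d'\in(\mathbb{Z}_{\ge1})^{n-1}$, writing $\mathbf d=(\mathbf d',d_n)$ and $p_b(\mathbf d')$ for the multiplicity of $b$ in $\mathbf d'$, $$\widehat C(\mathbf d)\sim\sum_{k=0}^\infty\frac{\widehat c_k(p_1(\mathbf d'),p_2(\mathbf d'),\dots)}{X(\mathbf d)^k}\qquad(d_n\to\infty),$$ that is, for every $L\ge0$ the difference of $\widehat C(\mathbf d)$ and the sum of the terms with $k<L$ is $O(X(\mathbf d)^{-L})$ as $d_n\to\infty$; 2. $\widehat c_0=1$, and for every $k\ge1$ the polynomial $\widehat c_k$ vanishes when all $p_b=0$; 3. if $p_d$ is given degree $2d+1$ for every $d\ge1$, then $\deg\widehat c_k\le k-1$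 for every $k\ge1$. -/

import Mathlib

open Filter Asymptotics
open scoped Nat

namespace BGW

/-- `X(𝐝) = ∑ (2 d_j + 1)`, for a tuple `𝐝` of natural numbers written as a list. -/
def X (l : List ℕ) : ℕ := (l.map fun d => 2 * d + 1).sum

/-- The genus `g(𝐝) = |𝐝| + 1`. -/
def genus (l : List ℕ) : ℕ := l.sum + 1

/-- `𝐝_I`: the entries of `𝐝` whose position lies in `I`, in their original order. -/
def restrict (l : List ℕ) (I : Finset (Fin l.length)) : List ℕ :=
  ((List.finRange l.length).filter (· ∈ I)).map l.get

theorem X_cons (d : ℕ) (l : List ℕ) : X (d :: l) = 2 * d + 1 + X l := by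
  simp [X]

theorem X_restrict_le (l : List ℕ) (I : Finset (Fin l.length)) : X (restrict l I) ≤ X l := by
  have h : ((List.finRange l.length).map l.get).map (fun d => 2 * d + 1)
      = l.map fun d => 2 * d + 1 := by simp
  unfold X
  rw [← h]
  refine List.Sublist.sum_le_sum ?_ (fun _ _ => Nat.zero_le _)
  exact ((List.filter_sublist).map _).map _

theorem X_set (l : List ℕ) (i : Fin l.length) (d : ℕ) :
    X (l.set i (l.get i + d)) = X l + 2 * d := by
  induction l with
  | nil => exact i.elim0
  | cons a l ih =>
    refine Fin.cases ?_ (fun j => ?_) i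
    · simp [X_cons]; ring
    · have := ih j
      simp only [List.get_eq_getElem] at this
      simp [X_cons, this]; ring

/-- `B(d_1, …, d_n) = ⟨τ_{d_1} ⋯ τ_{d_n}⟩^Θ ∏ (2 d_j + 1)!!`, determined by the initial value
`B(0) = 1/8` and the recursion (equivalent to the Virasoro constraints)
`B(d, 𝐝) = ∑ᵢ (2 dᵢ + 1) B(d₁, …, dᵢ + d, …, dₙ)
  + (1/2) ∑_{a + b = d - 1} (B(a, b, 𝐝) + ∑_{I ⊔ J = {1, …, n}} B(a, 𝐝_I) B(b, 𝐝_J))`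
for all other arguments. The value at the empty list is a dummy, used nowhere. -/
def B : List ℕ → ℚ
  | [] => 0
  | d :: l =>
    if d = 0 ∧ l = [] then 1 / 8
    else
      ∑ i : Fin l.length, (2 * (l.get i : ℚ) + 1) * B (l.set i (l.get i + d))
      + 1 / 2 * ∑ a : Fin d,
          (B (a :: (d - 1 - a) :: l)
            + ∑ I : Finset (Fin l.length),
                B (a :: restrict l I) * B ((d - 1 - a) :: restrict l Iᶜ))
termination_by l => X l
decreasing_by
  · rw [X_set, X_cons]; omega
  · simp only [X_cons]; omega
  · have := X_restrict_le l I
    simp only [X_cons]; omega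
  · have := X_restrict_le l Iᶜ
    simp only [X_cons]; omega

/-- The Brézin–Gross–Witten number `⟨τ_{d_1} ⋯ τ_{d_n}⟩^Θ_{g(𝐝)}`. -/
def bgw (l : List ℕ) : ℚ := B l / ((l.map fun d => (2 * d + 1)‼).prod : ℕ)

/-- The normalized BGW number `C(𝐝)`. -/
def C (l : List ℕ) : ℚ :=
  2 ^ (2 * genus l - 1) * ((l.map fun d => (2 * d + 1)‼).prod : ℕ) / ((X l - 1)! : ℕ) * bgw l

/-- `γ(X) = Γ(X/2 + 1)² / (π Γ((X+1)/2) Γ((X+3)/2))`. -/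
noncomputable def gam (x : ℝ) : ℝ :=
  Real.Gamma (x / 2 + 1) ^ 2 / (Real.pi * Real.Gamma ((x + 1) / 2) * Real.Gamma ((x + 3) / 2))

/-- The renormalized BGW number `Ĉ(𝐝) = C(𝐝) / γ(X(𝐝))`. -/
noncomputable def Chat (l : List ℕ) : ℝ := (C l : ℝ) / gam (X l)

/-- The multiplicity `p_r(𝐝)`, for `r = 1, 2, …`. -/
def mult (l : List ℕ) (r : ℕ+) : ℚ := (l.count (r : ℕ) : ℚ)

end BGW

/-!
For `Z = exp (∑ B)`, in the shuffle algebra of functions on words, the quadratic recursion becomes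
the linear Virasoro constraints `∂_d Z = (N_d + P_d / 2 + δ_{d,0} / 8) Z`. They force `Z` to be
symmetric, and they determine the one-point numbers, whose normalization is exactly `γ`.

Subtract `c_a / (2 a + 1)`, `c_a = 4 ^ (a + 1) w ^ (2 a + 1)`, from the times of `Z`. The shifted
numbers still satisfy Virasoro constraints. Hence their sums over subfamilies obey the recursion of
the normalized `Z(𝐝, m)`, where multiplication by `w ^ k` corresponds to division by
`(x - 1) ⋯ (x - k)` for `x = X(𝐝, m)`. So these sums are the inverse factorial expansions of
`Z(𝐝, m)` as `m → ∞`. Dividing by `Z` in the shuffle algebra, and then by `γ`, one obtains an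
expansion `∑_I f(𝐝_I)` of `Ĉ(𝐝, m)` with `f(∅) = 1` and `f(𝐝)` of order at least `X(𝐝) + 1`
otherwise. Thus each coefficient involves only words of bounded weight, and the sum of a symmetric
function over their occurrences among the subfamilies of `𝐝` is a polynomial in the multiplicities,
built from binomial coefficients.
-/

namespace BGW

/-! ### The shuffle algebra -/

/-- Functions on words in the alphabet `α`, with values in `K`. As a ring it carries the shuffle
product `(f * g)(𝐝) = ∑_{I ⊔ J} f(𝐝_I) g(𝐝_J)`, for which both the left and the right derivatives
are derivations. -/
structure Shuffle (α K : Type*) where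
  toFun : List α → K

namespace Shuffle

variable {α K : Type*}

instance : FunLike (Shuffle α K) (List α) K := ⟨toFun, fun ⟨_⟩ ⟨_⟩ h => congrArg mk h⟩

@[simp] theorem mk_apply (f : List α → K) (l : List α) : (⟨f⟩ : Shuffle α K) l = f l := rfl

@[ext] theorem ext {f g : Shuffle α K} (h : ∀ l, f l = g l) : f = g := DFunLike.ext f g h

variable [CommRing K]

instance : Zero (Shuffle α K) := ⟨⟨0⟩⟩

instance : Add (Shuffle α K) := ⟨fun f g => ⟨f + g⟩⟩

instance : Neg (Shuffle α K) := ⟨fun f => ⟨-f⟩⟩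

instance : Sub (Shuffle α K) := ⟨fun f g => ⟨f - g⟩⟩

instance {R : Type*} [SMul R K] : SMul R (Shuffle α K) := ⟨fun c f => ⟨c • ⇑f⟩⟩

instance : AddCommGroup (Shuffle α K) :=
  DFunLike.coe_injective.addCommGroup _ rfl (fun _ _ => rfl) (fun _ => rfl) (fun _ _ => rfl)
    (fun _ _ => rfl) fun _ _ => rfl

instance : Module K (Shuffle α K) :=
  Function.Injective.module K
    (⟨⟨DFunLike.coe, rfl⟩, fun _ _ => rfl⟩ : Shuffle α K →+ (List α → K))
    DFunLike.coe_injective fun _ _ => rfl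

@[simp] theorem zero_apply (l : List α) : (0 : Shuffle α K) l = 0 := rfl

@[simp] theorem add_apply (f g : Shuffle α K) (l : List α) : (f + g) l = f l + g l := rfl

@[simp] theorem sub_apply (f g : Shuffle α K) (l : List α) : (f - g) l = f l - g l := rfl

@[simp] theorem smul_apply (c : K) (f : Shuffle α K) (l : List α) : (c • f) l = c * f l := rfl

/-- Evaluation at a word. -/
def eval (l : List α) : Shuffle α K →ₗ[K] K where
  toFun f := f l
  map_add' _ _ := rfl
  map_smul' _ _ := rfl

@[simp] theorem sum_apply {ι : Type*} (s : Finset ι) (f : ι → Shuffle α K) (l : List α) :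
    (∑ i ∈ s, f i) l = ∑ i ∈ s, f i l :=
  map_sum (eval l) f s

/-- The left derivative `f ↦ f(a, ·)`. -/
def der (a : α) : Shuffle α K →ₗ[K] Shuffle α K where
  toFun f := ⟨fun l => f (a :: l)⟩
  map_add' _ _ := rfl
  map_smul' _ _ := rfl

/-- The right derivative `f ↦ f(·, a)`. -/
def rder (a : α) : Shuffle α K →ₗ[K] Shuffle α K where
  toFun f := ⟨fun l => f (l ++ [a])⟩
  map_add' _ _ := rfl
  map_smul' _ _ := rfl

@[simp] theorem der_apply (a : α) (f : Shuffle α K) (l : List α) : der a f l = f (a :: l) := rfl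

@[simp] theorem rder_apply (a : α) (f : Shuffle α K) (l : List α) :
    rder a f l = f (l ++ [a]) := rfl

theorem rder_der (a b : α) (f : Shuffle α K) : rder b (der a f) = der a (rder b f) := rfl

theorem ext_der {f g : Shuffle α K} (h0 : f [] = g []) (h : ∀ a, der a f = der a g) : f = g := by
  ext l
  cases l with
  | nil => exact h0
  | cons a l => exact DFunLike.congr_fun (h a) l

section Ring

/-- The value of the shuffle product of `f` and `g` at a word. -/
def mulAux : List α → Shuffle α K → Shuffle α K → K
  | [], f, g => f [] * g []
  | a :: l, f, g => mulAux l (der a f) g + mulAux l f (der a g)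

instance : Mul (Shuffle α K) := ⟨fun f g => ⟨fun l => mulAux l f g⟩⟩

instance : One (Shuffle α K) := ⟨⟨fun l => if l.isEmpty then 1 else 0⟩⟩

@[simp] theorem one_nil : (1 : Shuffle α K) [] = 1 := rfl

@[simp] theorem one_cons (a : α) (l : List α) : (1 : Shuffle α K) (a :: l) = 0 := rfl

@[simp] theorem der_one (a : α) : der a (1 : Shuffle α K) = 0 := rfl

@[simp] theorem mul_nil (f g : Shuffle α K) : (f * g) [] = f [] * g [] := rfl

theorem mul_cons (f g : Shuffle α K) (a : α) (l : List α) :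
    (f * g) (a :: l) = (der a f * g) l + (f * der a g) l := rfl

theorem der_mul (a : α) (f g : Shuffle α K) : der a (f * g) = der a f * g + f * der a g := rfl

private theorem mul_comm_shuffle (f g : Shuffle α K) : f * g = g * f := by
  ext l
  induction l generalizing f g with
  | nil => exact mul_comm _ _
  | cons a l ih => rw [mul_cons, mul_cons, ih, ih f, add_comm]

private theorem mul_add_shuffle (f g h : Shuffle α K) : f * (g + h) = f * g + f * h := by
  ext l
  induction l generalizing f g h with
  | nil => exact mul_add _ _ _
  | cons a l ih =>
    simp only [mul_cons, add_apply, map_add, ih]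
    ring

private theorem add_mul_shuffle (f g h : Shuffle α K) : (f + g) * h = f * h + g * h := by
  rw [mul_comm_shuffle, mul_add_shuffle, mul_comm_shuffle h, mul_comm_shuffle h]

private theorem smul_mul_shuffle (c : K) (f g : Shuffle α K) : c • f * g = c • (f * g) := by
  ext l
  induction l generalizing f g with
  | nil => exact mul_assoc _ _ _
  | cons a l ih => simp only [mul_cons, smul_apply, map_smul, ih, mul_add]

private theorem zero_mul_shuffle (f : Shuffle α K) : 0 * f = 0 := by
  simpa using smul_mul_shuffle (0 : K) 0 f

private theorem one_mul_shuffle (f : Shuffle α K) : 1 * f = f := by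
  ext l
  induction l generalizing f with
  | nil => exact one_mul _
  | cons a l ih => rw [mul_cons, der_one, zero_mul_shuffle, ih, zero_apply, zero_add, der_apply]

private theorem mul_assoc_shuffle (f g h : Shuffle α K) : f * g * h = f * (g * h) := by
  ext l
  induction l generalizing f g h with
  | nil => exact mul_assoc _ _ _
  | cons a l ih =>
    simp only [mul_cons, der_mul, add_mul_shuffle, mul_add_shuffle, add_apply, ih]
    ring

instance : CommRing (Shuffle α K) where
  __ := (inferInstance : AddCommGroup (Shuffle α K))
  mul_assoc := mul_assoc_shuffle
  one_mul := one_mul_shuffle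
  mul_one f := by rw [mul_comm_shuffle, one_mul_shuffle]
  mul_comm := mul_comm_shuffle
  left_distrib := mul_add_shuffle
  right_distrib := add_mul_shuffle
  zero_mul := zero_mul_shuffle
  mul_zero f := by rw [mul_comm_shuffle, zero_mul_shuffle]

instance : Algebra K (Shuffle α K) :=
  Algebra.ofModule smul_mul_shuffle fun c f g => by
    rw [mul_comm, smul_mul_shuffle, mul_comm]

theorem rder_mul (a : α) (f g : Shuffle α K) : rder a (f * g) = rder a f * g + f * rder a g := by
  ext l
  induction l generalizing f g with
  | nil => simp [mul_cons]
  | cons b l ih =>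
    have h₁ := ih (der b f) g
    have h₂ := ih f (der b g)
    simp only [rder_apply, add_apply, rder_der, List.cons_append, mul_cons] at h₁ h₂ ⊢
    rw [h₁, h₂]
    ring

theorem mul_apply_congr {f f' g g' : Shuffle α K} {l : List α}
    (hf : ∀ l', l'.Sublist l → f l' = f' l') (hg : ∀ l', l'.Sublist l → g l' = g' l') :
    (f * g) l = (f' * g') l := by
  induction l generalizing f f' g g' with
  | nil => rw [mul_nil, mul_nil, hf _ List.Sublist.slnil, hg _ List.Sublist.slnil]
  | cons a l ih =>
    rw [mul_cons, mul_cons,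
      ih (f' := der a f') (fun l' h => hf (a :: l') (h.cons_cons a)) fun l' h => hg l' (h.cons a),
      ih (g' := der a g') (fun l' h => hf l' (h.cons a)) fun l' h => hg (a :: l') (h.cons_cons a)]

theorem mul_apply_of_forall_proper_eq_zero {f : Shuffle α K} (g : Shuffle α K) {l : List α}
    (h : ∀ l', l'.Sublist l → l' ≠ l → f l' = 0) : (f * g) l = f l * g [] := by
  induction l generalizing f with
  | nil => rfl
  | cons a l ih =>
    have hf : (f * der a g) l = 0 := by
      rw [mul_apply_congr (f' := 0) (g' := der a g) (fun l' hl' => h l' (hl'.cons a) ?_)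
        fun _ _ => rfl, zero_mul, zero_apply]
      rintro rfl
      exact absurd hl'.length_le (by simp)
    rw [mul_cons, hf, add_zero, ih fun l' hl' hne =>
      h (a :: l') (hl'.cons_cons a) (by simpa using hne),
      der_apply]

end Ring

section Exp

/-- `expAux f l h` is the value of `h * exp f` at `l`. -/
def expAux (f : Shuffle α K) : List α → Shuffle α K → K
  | [], h => h []
  | a :: l, h => expAux f l (der a h + h * der a f)

/-- The exponential of `f` for the shuffle product; the value `f []` is ignored. -/
def exp (f : Shuffle α K) : Shuffle α K := ⟨fun l => expAux f l 1⟩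

@[simp] theorem exp_nil (f : Shuffle α K) : exp f [] = 1 := rfl

theorem exp_cons (f : Shuffle α K) (a : α) (l : List α) :
    exp f (a :: l) = expAux f l (der a f) := by
  rw [exp, mk_apply, expAux, der_one, one_mul, zero_add]

theorem expAux_eq_mul_exp (f h : Shuffle α K) (l : List α) : expAux f l h = (h * exp f) l := by
  induction hn : l.length using Nat.strong_induction_on generalizing l h with
  | _ n ih =>
    cases l with
    | nil => simp [expAux]
    | cons a l =>
      have hlt : ∀ l' : List α, l'.Sublist l → l'.length < n := fun l' hl' => by
        rw [← hn, List.length_cons]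
        exact Nat.lt_succ_of_le hl'.length_le
      have hder : (h * der a (exp f)) l = (h * (der a f * exp f)) l :=
        mul_apply_congr (fun _ _ => rfl) fun l' hl' => by
          rw [der_apply, exp_cons, ih _ (hlt l' hl') _ _ rfl]
      rw [expAux, ih _ (hlt l (List.Sublist.refl l)) _ _ rfl, mul_cons, hder, add_mul, add_apply,
        mul_assoc]

theorem der_exp (f : Shuffle α K) (a : α) : der a (exp f) = der a f * exp f := by
  ext l
  rw [der_apply, exp_cons, expAux_eq_mul_exp]

theorem linear_system_unique {f u v : Shuffle α K} {r : α → Shuffle α K} (h0 : u [] = v [])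
    (hu : ∀ a, der a u = der a f * u + r a) (hv : ∀ a, der a v = der a f * v + r a) : u = v := by
  ext l
  induction hn : l.length using Nat.strong_induction_on generalizing l with
  | _ n ih =>
    cases l with
    | nil => exact h0
    | cons a l =>
      have hu' := DFunLike.congr_fun (hu a) l
      have hv' := DFunLike.congr_fun (hv a) l
      rw [der_apply, add_apply] at hu' hv'
      rw [hu', hv']
      congr 1
      refine mul_apply_congr (fun _ _ => rfl) fun l' hl' => ih l'.length ?_ l' rfl
      rw [← hn, List.length_cons]
      exact Nat.lt_succ_of_le hl'.length_le

theorem exp_mul_exp_neg (f : Shuffle α K) : exp f * exp (-f) = 1 :=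
  ext_der (by simp) fun a => by
    rw [der_mul, der_exp, der_exp, map_neg, der_one]
    ring

theorem rder_exp (f : Shuffle α K) (a : α) : rder a (exp f) = rder a f * exp f := by
  refine linear_system_unique (f := f) (r := fun b => rder a (der b f) * exp f) ?_ ?_ ?_
  · simpa using DFunLike.congr_fun (der_exp f a) []
  · intro b
    rw [← rder_der, der_exp, rder_mul, add_comm]
  · intro b
    rw [der_mul, der_exp, rder_der]
    ring

end Exp

section Symmetric

/-- Invariance under permutations of the arguments. -/
def Symmetric (f : Shuffle α K) : Prop := ∀ l l' : List α, l.Perm l' → f l = f l'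

namespace Symmetric

variable {f g : Shuffle α K}

omit [CommRing K] in
theorem of_cons_of_swap (hcons : ∀ a l l', l.Perm l' → f l = f l' → f (a :: l) = f (a :: l'))
    (hswap : ∀ a b l, f (a :: b :: l) = f (b :: a :: l)) : Symmetric f := by
  intro l l' h
  induction h with
  | nil => rfl
  | cons a h ih => exact hcons a _ _ h ih
  | swap a b l => exact hswap b a l
  | trans _ _ ih₁ ih₂ => exact ih₁.trans ih₂

theorem add (hf : Symmetric f) (hg : Symmetric g) : Symmetric (f + g) := fun l l' h => by
  rw [add_apply, add_apply, hf l l' h, hg l l' h]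

theorem smul (hf : Symmetric f) (c : K) : Symmetric (c • f) := fun l l' h => by
  rw [smul_apply, smul_apply, hf l l' h]

theorem sum {ι : Type*} {s : Finset ι} {F : ι → Shuffle α K} (h : ∀ i ∈ s, Symmetric (F i)) :
    Symmetric (∑ i ∈ s, F i) := fun l l' hl => by
  rw [sum_apply, sum_apply]
  exact Finset.sum_congr rfl fun i hi => h i hi l l' hl

theorem der (hf : Symmetric f) (a : α) : Symmetric (der a f) := fun _ _ h => hf _ _ (h.cons a)

theorem der_comm (hf : Symmetric f) (a b : α) :
    Shuffle.der a (Shuffle.der b f) = Shuffle.der b (Shuffle.der a f) :=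
  ext fun l => hf _ _ (List.Perm.swap a b l)

theorem one : Symmetric (1 : Shuffle α K) :=
  of_cons_of_swap (fun _ _ _ _ _ => rfl) fun _ _ _ => rfl

theorem mul (hf : Symmetric f) (hg : Symmetric g) : Symmetric (f * g) := by
  intro l l' h
  induction h generalizing f g with
  | nil => rfl
  | cons a _ ih => rw [mul_cons, mul_cons, ih (hf.der a) hg, ih hf (hg.der a)]
  | swap a b l =>
    simp only [mul_cons]
    rw [hf.der_comm a b, hg.der_comm a b]
    ring
  | trans _ _ ih₁ ih₂ => rw [ih₁ hf hg, ih₂ hf hg]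

theorem of_mul (hg : Symmetric g) (hg1 : g [] = 1) (h : Symmetric (f * g)) : Symmetric f := by
  classical
  intro l l' hp
  induction hn : l.length using Nat.strong_induction_on generalizing l l' with
  | _ n ih =>
    let f' : Shuffle α K := ⟨fun l => if l.length < n then f l else 0⟩
    have hf' : Symmetric f' := fun a b hab => by
      simp only [f', mk_apply, hab.length_eq]
      split_ifs with hb
      · exact ih a.length (hab.length_eq ▸ hb) a b hab rfl
      · rfl
    have key : ∀ a : List α, a.length = n → f a = (f * g) a - (f' * g) a := fun a ha => by
      have hzero : ∀ l', l'.Sublist a → l' ≠ a → (f - f') l' = 0 := fun l' hl' hne => by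
        have hlt : l'.length < n :=
          ha ▸ lt_of_le_of_ne hl'.length_le fun he => hne (hl'.eq_of_length he)
        simp [f', hlt]
      rw [← sub_apply, ← sub_mul, mul_apply_of_forall_proper_eq_zero g hzero, hg1]
      simp [f', ha]
    rw [key l hn, key l' (hp.length_eq ▸ hn), h _ _ hp, (hf'.mul hg) _ _ hp]

end Symmetric

end Symmetric

end Shuffle

/-! ### Virasoro constraints -/

namespace Shuffle

section Raise

variable {K : Type*} [CommRing K]

/-- The value of `raise d f` at a word. -/
def raiseAux (d : ℕ) : List ℕ → Shuffle ℕ K → K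
  | [], _ => 0
  | e :: l, f => (2 * e + 1) * f ((e + d) :: l) + raiseAux d l (der e f)

/-- The raising operator `N_d`, the derivation
`(N_d f)(𝐝) = ∑ᵢ (2 dᵢ + 1) f(d₁, …, dᵢ + d, …, dₙ)`. -/
def raise (d : ℕ) : Shuffle ℕ K →ₗ[K] Shuffle ℕ K where
  toFun f := ⟨fun l => raiseAux d l f⟩
  map_add' f g := by
    ext l
    induction l generalizing f g with
    | nil => simp [raiseAux]
    | cons e l ih =>
      simp only [mk_apply, add_apply, raiseAux, map_add] at ih ⊢
      rw [ih]
      ring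
  map_smul' c f := by
    ext l
    induction l generalizing f with
    | nil => simp [raiseAux]
    | cons e l ih =>
      simp only [mk_apply, smul_apply, raiseAux, map_smul, RingHom.id_apply] at ih ⊢
      rw [ih]
      ring

@[simp] theorem raise_nil (d : ℕ) (f : Shuffle ℕ K) : raise d f [] = 0 := rfl

theorem raise_cons (d : ℕ) (f : Shuffle ℕ K) (e : ℕ) (l : List ℕ) :
    raise d f (e :: l) = (2 * e + 1) * f ((e + d) :: l) + raise d (der e f) l := rfl

theorem der_raise (d e : ℕ) (f : Shuffle ℕ K) :
    der e (raise d f) = (2 * e + 1 : K) • der (e + d) f + raise d (der e f) := rfl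

theorem raise_apply (d : ℕ) (f : Shuffle ℕ K) (l : List ℕ) :
    raise d f l = ∑ i : Fin l.length, (2 * (l.get i : K) + 1) * f (l.set i (l.get i + d)) := by
  induction l generalizing f with
  | nil => simp
  | cons e l ih =>
    rw [raise_cons, ih]
    simp [Fin.sum_univ_succ]

theorem raise_apply_congr {d : ℕ} {f g : Shuffle ℕ K} {l : List ℕ}
    (h : ∀ l', X l' = X l + 2 * d → l'.length = l.length → f l' = g l') :
    raise d f l = raise d g l := by
  simp only [raise_apply]
  exact Finset.sum_congr rfl fun i _ => by rw [h _ (X_set l i d) List.length_set]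

theorem raise_append_singleton (d : ℕ) (f : Shuffle ℕ K) (l : List ℕ) (m : ℕ) :
    raise d f (l ++ [m]) = raise d (rder m f) l + (2 * m + 1) * rder (m + d) f l := by
  induction l generalizing f with
  | nil => simp [raise_cons]
  | cons e l ih =>
    rw [List.cons_append, raise_cons, raise_cons, ih, rder_der, rder_der, add_assoc]
    rfl

theorem raise_mul (d : ℕ) (f g : Shuffle ℕ K) :
    raise d (f * g) = raise d f * g + f * raise d g := by
  ext l
  induction l generalizing f g with
  | nil => simp
  | cons e l ih =>
    have hf := ih (der e f) g
    have hg := ih f (der e g)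
    simp only [raise_cons, add_apply] at hf hg ⊢
    simp only [der_mul, map_add, mul_cons, der_raise, add_apply, hf, hg, add_mul, mul_add,
      smul_mul_assoc, mul_smul_comm, smul_apply]
    ring

theorem raise_exp (d : ℕ) (f : Shuffle ℕ K) : raise d (exp f) = raise d f * exp f := by
  refine linear_system_unique (f := f) (r := fun e => der e (raise d f) * exp f) (by simp) ?_ ?_
  · intro e
    rw [der_raise, der_exp, der_exp, raise_mul, der_raise, add_mul, smul_mul_assoc]
    ring
  · intro e
    rw [der_mul, der_exp]
    ring

theorem raise_commutator (d e : ℕ) (f : Shuffle ℕ K) :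
    raise d (raise e f) - raise e (raise d f) = (2 * (d - e) : K) • raise (d + e) f := by
  ext l
  induction l generalizing f with
  | nil => simp
  | cons a l ih =>
    have h := ih (der a f)
    simp only [sub_apply, smul_apply, raise_cons, der_raise, map_add, map_smul,
      add_apply] at h ⊢
    rw [add_right_comm a d e, add_assoc a e d, add_comm e d]
    push_cast
    linear_combination h

theorem Symmetric.raise {f : Shuffle ℕ K} (hf : Symmetric f) (d : ℕ) : Symmetric (raise d f) := by
  intro l l' h
  induction h generalizing f with
  | nil => rfl
  | cons e h ih => rw [raise_cons, raise_cons, ih (hf.der e), hf _ _ (h.cons (e + d))]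
  | swap a b l =>
    simp only [raise_cons, der_apply]
    rw [hf.der_comm a b, hf _ _ (List.Perm.swap a (b + d) l),
      hf _ _ (List.Perm.swap (a + d) b l)]
    ring
  | trans _ _ ih₁ ih₂ => rw [ih₁ hf, ih₂ hf]

end Raise

end Shuffle

section Pairs

/-- The pairs `(a, b)` of natural numbers with `a + b = d - 1`; there are none for `d = 0`. -/
def pairs : ℕ → Finset (ℕ × ℕ)
  | 0 => ∅
  | d + 1 => Finset.HasAntidiagonal.antidiagonal d

@[simp] theorem pairs_zero : pairs 0 = ∅ := rfl

theorem mem_pairs {d : ℕ} {p : ℕ × ℕ} : p ∈ pairs d ↔ p.1 + p.2 + 1 = d := by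
  cases d with
  | zero => simp
  | succ d => simp [pairs]

variable {M : Type*} [AddCommMonoid M]

theorem sum_pairs (d : ℕ) (F : ℕ × ℕ → M) :
    ∑ p ∈ pairs d, F p = ∑ a ∈ Finset.range d, F (a, d - 1 - a) := by
  cases d with
  | zero => simp
  | succ d => exact Finset.Nat.sum_antidiagonal_eq_sum_range_succ_mk F d

theorem sum_pairs_swap (d : ℕ) (F : ℕ × ℕ → M) :
    ∑ p ∈ pairs d, F p.swap = ∑ p ∈ pairs d, F p :=
  Finset.sum_equiv (Equiv.prodComm ℕ ℕ)
    (fun p => by rw [mem_pairs, mem_pairs, Equiv.prodComm_apply, Prod.fst_swap, Prod.snd_swap,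
      add_comm p.2]) fun _ _ => rfl

theorem sum_pairs_add (d e : ℕ) (F : ℕ × ℕ → M) :
    ∑ p ∈ pairs (d + e), F p
      = ∑ p ∈ pairs d, F (p.1, p.2 + e) + ∑ p ∈ pairs e, F (p.1 + d, p.2) := by
  rw [sum_pairs, sum_pairs, sum_pairs, Finset.sum_range_add]
  congr 1
  · refine Finset.sum_congr rfl fun a ha => ?_
    have := Finset.mem_range.mp ha
    rw [show d + e - 1 - a = d - 1 - a + e by omega]
  · refine Finset.sum_congr rfl fun a _ => ?_
    rw [show d + e - 1 - (d + a) = e - 1 - a by omega, add_comm d a]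

-- Writing both sums on the left over `pairs (d + e)`, the weights become those of a single affine
-- function of `a`, whose average with its reflection is `d - e`.
theorem two_mul_sum_pairs_sub {K : Type*} [CommRing K] (d e : ℕ) {T : ℕ × ℕ → K}
    (hT : ∀ p, T p.swap = T p) :
    2 * (∑ p ∈ pairs d, (2 * (p.1 : K) + 1) * T (p.1 + e, p.2)
        - ∑ p ∈ pairs e, (2 * (p.1 : K) + 1) * T (p.1 + d, p.2))
      = 2 * (d - e) * ∑ p ∈ pairs (d + e), T p := by
  have hd : ∑ p ∈ pairs d, (2 * (p.1 : K) + 1) * T (p.1 + e, p.2)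
      = ∑ p ∈ pairs d, (2 * (p.2 : K) + 1) * T (p.1, p.2 + e) := by
    rw [← sum_pairs_swap]
    exact Finset.sum_congr rfl fun p _ => by rw [← hT]; rfl
  have hsplit : ∑ p ∈ pairs d, (2 * (p.1 : K) + 1) * T (p.1 + e, p.2)
      - ∑ p ∈ pairs e, (2 * (p.1 : K) + 1) * T (p.1 + d, p.2)
      = ∑ p ∈ pairs (d + e), (2 * (p.2 - e : K) + 1) * T p := by
    rw [hd, sum_pairs_add, sub_eq_add_neg, ← Finset.sum_neg_distrib]
    congr 1
    · exact Finset.sum_congr rfl fun p _ => by push_cast; ring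
    · refine Finset.sum_congr rfl fun p hp => ?_
      rw [← mem_pairs.mp hp]
      push_cast
      ring
  have hreflect : ∑ p ∈ pairs (d + e), (2 * (p.2 - e : K) + 1) * T p
      = ∑ p ∈ pairs (d + e), (2 * (p.1 - e : K) + 1) * T p := by
    rw [← sum_pairs_swap]
    exact Finset.sum_congr rfl fun p _ => by rw [hT]; rfl
  rw [hsplit, two_mul]
  nth_rw 2 [hreflect]
  rw [← Finset.sum_add_distrib, Finset.mul_sum]
  refine Finset.sum_congr rfl fun p hp => ?_
  have h : (p.1 + p.2 + 1 : K) = d + e := by exact_mod_cast congrArg Nat.cast (mem_pairs.mp hp)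
  linear_combination 2 * T p * h

end Pairs

theorem X_perm {l l' : List ℕ} (h : l.Perm l') : X l = X l' := (h.map _).sum_eq

namespace Shuffle

section Virasoro

variable {K : Type*} [CommRing K]

/-- The operator `P_d = ∑_{a + b = d - 1} ∂_a ∂_b`, where `∂_a` are the left derivatives. -/
def pairDer (d : ℕ) : Shuffle ℕ K →ₗ[K] Shuffle ℕ K := ∑ p ∈ pairs d, der p.2 ∘ₗ der p.1

theorem pairDer_eq_sum (d : ℕ) (f : Shuffle ℕ K) :
    pairDer d f = ∑ p ∈ pairs d, der p.2 (der p.1 f) := by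
  simp [pairDer]

theorem pairDer_apply (d : ℕ) (f : Shuffle ℕ K) (l : List ℕ) :
    pairDer d f l = ∑ p ∈ pairs d, f (p.1 :: p.2 :: l) := by
  simp [pairDer_eq_sum]

/-- The Virasoro operators `A_d = N_d + u P_d + v δ_{d,0}`. The disconnected numbers solve the
constraints `∂_d = A_d` with `u = 1/2` and `v = 1/8`; rescalings of them do so for other values. -/
def vir (u v : K) (d : ℕ) : Shuffle ℕ K →ₗ[K] Shuffle ℕ K :=
  raise d + u • pairDer d + (if d = 0 then v else 0) • LinearMap.id

variable {u v : K}

theorem vir_eq (d : ℕ) (f : Shuffle ℕ K) :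
    vir u v d f = raise d f + u • pairDer d f + (if d = 0 then v else 0) • f := rfl

theorem vir_apply (d : ℕ) (f : Shuffle ℕ K) (l : List ℕ) :
    vir u v d f l = raise d f l + u * pairDer d f l + (if d = 0 then v else 0) * f l := rfl

theorem vir_apply_congr {d : ℕ} {f g : Shuffle ℕ K} {l : List ℕ}
    (h : ∀ l', X l' = X l + 2 * d → f l' = g l') : vir u v d f l = vir u v d g l := by
  have hpair : pairDer d f l = pairDer d g l := by
    rw [pairDer_apply, pairDer_apply]
    refine Finset.sum_congr rfl fun p hp => h _ ?_
    have := mem_pairs.mp hp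
    simp only [X_cons]
    omega
  have hdelta : (if d = 0 then v else 0) * f l = (if d = 0 then v else 0) * g l := by
    split_ifs with hd
    · rw [h l (by omega)]
    · simp only [zero_mul]
  rw [vir_apply, vir_apply, raise_apply_congr fun l' hl' _ => h l' hl', hpair, hdelta]

theorem Symmetric.pairDer {f : Shuffle ℕ K} (hf : Symmetric f) (d : ℕ) :
    Symmetric (pairDer d f) := by
  rw [pairDer_eq_sum]
  exact Symmetric.sum fun p _ => (hf.der p.1).der p.2

theorem Symmetric.vir {f : Shuffle ℕ K} (hf : Symmetric f) (d : ℕ) : Symmetric (vir u v d f) :=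
  ((hf.raise d).add ((hf.pairDer d).smul u)).add (hf.smul _)

theorem Symmetric.der_pairDer {f : Shuffle ℕ K} (hf : Symmetric f) (d e : ℕ) :
    Shuffle.der e (Shuffle.pairDer d f) = Shuffle.pairDer d (Shuffle.der e f) := by
  rw [pairDer_eq_sum, pairDer_eq_sum, map_sum]
  refine Finset.sum_congr rfl fun p _ => ?_
  rw [(hf.der p.1).der_comm, hf.der_comm]

theorem Symmetric.der_vir {f : Shuffle ℕ K} (hf : Symmetric f) (d e : ℕ) :
    Shuffle.der e (Shuffle.vir u v d f)
      = (2 * e + 1 : K) • Shuffle.der (e + d) f + Shuffle.vir u v d (Shuffle.der e f) := by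
  rw [vir_eq, vir_eq, map_add, map_add, map_smul, map_smul, der_raise, hf.der_pairDer]
  simp only [add_assoc]

theorem Symmetric.pairDer_raise {f : Shuffle ℕ K} (hf : Symmetric f) (d e : ℕ) :
    Shuffle.pairDer e (Shuffle.raise d f) = Shuffle.raise d (Shuffle.pairDer e f)
      + (2 : K) • ∑ p ∈ pairs e,
          (2 * p.1 + 1 : K) • Shuffle.der p.2 (Shuffle.der (p.1 + d) f) := by
  have hswap : ∑ p ∈ pairs e, (2 * p.2 + 1 : K) • Shuffle.der (p.2 + d) (Shuffle.der p.1 f)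
      = ∑ p ∈ pairs e, (2 * p.1 + 1 : K) • Shuffle.der p.2 (Shuffle.der (p.1 + d) f) := by
    rw [← sum_pairs_swap]
    exact Finset.sum_congr rfl fun p _ => by rw [hf.der_comm]; rfl
  simp only [pairDer_eq_sum, der_raise, map_add, map_smul, map_sum, Finset.sum_add_distrib]
  rw [hswap, two_smul]
  abel

theorem Symmetric.vir_commutator {f : Shuffle ℕ K} (hf : Symmetric f) (d e : ℕ) :
    Shuffle.vir u v d (Shuffle.vir u v e f) - Shuffle.vir u v e (Shuffle.vir u v d f)
      = (2 * (d - e) : K) • Shuffle.vir u v (d + e) f := by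
  have hpair :
      (2 : K) • ∑ p ∈ pairs d, (2 * p.1 + 1 : K) • Shuffle.der p.2 (Shuffle.der (p.1 + e) f)
      - (2 : K) • ∑ p ∈ pairs e, (2 * p.1 + 1 : K) • Shuffle.der p.2 (Shuffle.der (p.1 + d) f)
      = (2 * (d - e) : K) • Shuffle.pairDer (d + e) f := by
    ext l
    have := two_mul_sum_pairs_sub d e (T := fun p => f (p.1 :: p.2 :: l))
      fun p => hf _ _ (List.Perm.swap p.1 p.2 l)
    simpa [pairDer_apply, mul_sub] using this
  have hcomm : Shuffle.pairDer d (Shuffle.pairDer e f)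
      = Shuffle.pairDer e (Shuffle.pairDer d f) := by
    simp only [pairDer_eq_sum d, map_sum]
    exact Finset.sum_congr rfl fun p _ => by rw [hf.der_pairDer, (hf.der p.1).der_pairDer]
  have hdelta : (2 * (d - e) * (if d + e = 0 then v else 0) : K) • f = 0 := by
    split_ifs with h
    · simp [show d = 0 by omega, show e = 0 by omega]
    · simp
  have hraise := raise_commutator d e f
  simp only [vir_eq, map_add, map_smul, hf.pairDer_raise]
  linear_combination (norm := module) hraise + u • hpair + (u * u) • hcomm - hdelta

/-- The solutions of the Virasoro constraints `∂_d f = A_d f`. -/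
def IsVirasoro (u v : K) (f : Shuffle ℕ K) : Prop := ∀ d, der d f = vir u v d f

namespace IsVirasoro

variable {f g : Shuffle ℕ K} {n : ℕ}

theorem apply_cons (hf : IsVirasoro u v f) (d : ℕ) (l : List ℕ) : f (d :: l) = vir u v d f l :=
  DFunLike.congr_fun (hf d) l

theorem cons_eq_vir (hf : IsVirasoro u v f) (hg : ∀ l, X l < n → g l = f l) {d : ℕ} {l : List ℕ}
    (hl : X (d :: l) ≤ n) : f (d :: l) = vir u v d g l := by
  rw [hf.apply_cons]
  refine vir_apply_congr fun l' hl' => (hg l' ?_).symm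
  rw [X_cons] at hl
  omega

-- The Virasoro commutation relations are the integrability conditions of the constraints.
theorem swap (hf : IsVirasoro u v f) (hs : Symmetric g) (hg : ∀ l, X l < n → g l = f l)
    {d e : ℕ} {l : List ℕ} (hl : X (d :: e :: l) ≤ n) : f (d :: e :: l) = f (e :: d :: l) := by
  have expand : ∀ d e, X (d :: e :: l) ≤ n → f (d :: e :: l)
      = (2 * e + 1) * g ((e + d) :: l) + vir u v d (vir u v e g) l := fun d e h => by
    rw [hf.cons_eq_vir hg h, ← der_apply, hs.der_vir, add_apply, smul_apply, der_apply]
    simp only [X_cons] at h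
    congr 1
    refine vir_apply_congr fun l' hl' => ?_
    rw [der_apply, hg _ (by rw [X_cons]; omega)]
    exact hf.cons_eq_vir (fun l h => hg l h) (by rw [X_cons]; omega)
  have hcomm := DFunLike.congr_fun (hs.vir_commutator (u := u) (v := v) d e) l
  have hl' := hl
  simp only [X_cons] at hl
  have hmerge : g ((d + e) :: l) = vir u v (d + e) g l := by
    rw [hg _ (by rw [X_cons]; omega)]
    exact hf.cons_eq_vir hg (by rw [X_cons]; omega)
  rw [expand d e hl', expand e d (by simp only [X_cons]; omega), add_comm e d, hmerge]
  rw [sub_apply, smul_apply] at hcomm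
  linear_combination hcomm

theorem symmetric (hf : IsVirasoro u v f) : Symmetric f := by
  suffices ∀ n l l', l.Perm l' → X l < n → f l = f l' from
    fun l l' h => this _ l l' h (Nat.lt_succ_self _)
  intro n
  induction n with
  | zero => exact fun l l' _ h => absurd h (Nat.not_lt_zero _)
  | succ n ih =>
    let g : Shuffle ℕ K := ⟨fun l => if X l < n then f l else 0⟩
    have hg : ∀ l, X l < n → g l = f l := fun l hl => if_pos hl
    have hs : Symmetric g := fun l l' h => by
      simp only [g, mk_apply, X_perm h]
      split_ifs with hlt
      · exact ih l l' h (X_perm h ▸ hlt)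
      · rfl
    intro l l' h hl
    induction h with
    | nil => rfl
    | cons a h _ =>
      rw [hf.cons_eq_vir hg (Nat.le_of_lt_succ hl),
        hf.cons_eq_vir hg (Nat.le_of_lt_succ (X_perm (h.cons a) ▸ hl)), hs.vir a _ _ h]
    | swap a b l => exact hf.swap hs hg (Nat.le_of_lt_succ hl)
    | trans h _ ih₁ ih₂ => exact (ih₁ hl).trans (ih₂ (X_perm h ▸ hl))

end IsVirasoro

end Virasoro

end Shuffle

/-! ### Disconnected numbers -/

open Shuffle

section Splittings

theorem sum_finset_fin_succ {M : Type*} [AddCommMonoid M] (n : ℕ) (F : Finset (Fin (n + 1)) → M) :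
    ∑ I, F I = ∑ J : Finset (Fin n), F (insert 0 (J.image Fin.succ))
      + ∑ J : Finset (Fin n), F (J.image Fin.succ) := by
  have h0 : (0 : Fin (n + 1)) ∉ (Finset.univ : Finset (Fin n)).image Fin.succ := by simp
  have hinj : Set.InjOn (Finset.image (Fin.succ : Fin n → Fin (n + 1)))
      ((Finset.univ : Finset (Finset (Fin n))) : Set (Finset (Fin n))) :=
    (Finset.image_injective (Fin.succ_injective n)).injOn
  rw [← Finset.powerset_univ, Fin.univ_succ, Finset.cons_eq_insert, Finset.map_eq_image,
    Function.Embedding.coeFn_mk, Finset.sum_powerset_insert h0, Finset.powerset_image,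
    Finset.powerset_univ, Finset.sum_image hinj, Finset.sum_image hinj, add_comm]

theorem restrict_cons (a : ℕ) (l : List ℕ) {I : Finset (Fin (l.length + 1))}
    {J : Finset (Fin l.length)} (h : ∀ i, i.succ ∈ I ↔ i ∈ J) :
    restrict (a :: l) I = if 0 ∈ I then a :: restrict l J else restrict l J := by
  have htail : ((List.finRange l.length).map Fin.succ).filter (· ∈ I)
      = ((List.finRange l.length).filter (· ∈ J)).map Fin.succ := by
    rw [List.filter_map]
    congr 1
    exact List.filter_congr fun i _ => by simp [h i]
  simp only [restrict, List.length_cons, List.finRange_succ, List.filter_cons, htail]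
  split_ifs <;> simp_all [Function.comp_def]

theorem Shuffle.sum_restrict_mul_restrict_compl {K : Type*} [CommRing K] (f g : Shuffle ℕ K)
    (l : List ℕ) :
    ∑ I : Finset (Fin l.length), f (restrict l I) * g (restrict l Iᶜ) = (f * g) l := by
  induction l generalizing f g with
  | nil =>
    exact Fintype.sum_eq_single (∅ : Finset (Fin 0)) fun I hI => absurd (Subsingleton.elim I _) hI
  | cons a l ih =>
    rw [mul_cons, ← ih, ← ih]
    refine (sum_finset_fin_succ l.length _).trans ?_
    congr 1 <;>
    · refine Finset.sum_congr rfl fun J _ => ?_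
      rw [restrict_cons a l (J := J) (by simp), restrict_cons a l (J := Jᶜ) (by simp)]
      simp

end Splittings

/-- The numbers `B` as a function on words; they are the connected numbers, of which `Z` below is
the disconnected version. -/
def conn : Shuffle ℕ ℚ := ⟨B⟩

/-- The disconnected numbers, with generating series the partition function `exp (∑ B)`. -/
def Z : Shuffle ℕ ℚ := exp conn

/-- The inverse of `Z` for the shuffle product. -/
def Zinv : Shuffle ℕ ℚ := exp (-conn)

@[simp] theorem Z_nil : Z [] = 1 := rfl

theorem Z_mul_Zinv : Z * Zinv = 1 := exp_mul_exp_neg conn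

theorem der_conn (d : ℕ) :
    der d conn = raise d conn
      + (1 / 2 : ℚ) • ∑ p ∈ pairs d, (der p.2 (der p.1 conn) + der p.1 conn * der p.2 conn)
      + (if d = 0 then 1 / 8 else 0 : ℚ) • 1 := by
  ext l
  rw [der_apply, conn, mk_apply, B]
  by_cases hd : d = 0
  · subst hd
    cases l with
    | nil => simp
    | cons a l => simp [raise_apply]
  · rw [if_neg (not_and_of_not_left _ hd), if_neg hd, sum_pairs, Finset.sum_range]
    simp only [Shuffle.add_apply, Shuffle.smul_apply, Shuffle.sum_apply, raise_apply, zero_mul,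
      add_zero, ← sum_restrict_mul_restrict_compl]
    rfl

theorem isVirasoro_Z : IsVirasoro (1 / 2) (1 / 8) Z := fun d => by
  have hpair : pairDer d Z
      = (∑ p ∈ pairs d, (der p.2 (der p.1 conn) + der p.1 conn * der p.2 conn)) * Z := by
    rw [pairDer_eq_sum, Finset.sum_mul]
    refine Finset.sum_congr rfl fun p _ => ?_
    rw [Z, der_exp, der_mul, der_exp]
    ring
  rw [vir_eq, hpair, Z, der_exp, der_conn, raise_exp, add_mul, add_mul, smul_mul_assoc,
    smul_mul_assoc, one_mul]

theorem symmetric_Z : Symmetric Z := isVirasoro_Z.symmetric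

theorem symmetric_Zinv : Symmetric Zinv :=
  symmetric_Z.of_mul rfl <| by
    rw [mul_comm, Z_mul_Zinv]
    exact Symmetric.one

theorem rder_conn (m : ℕ) : rder m conn = rder m Z * Zinv := by
  rw [Z, rder_exp, mul_assoc, ← Z, Z_mul_Zinv, mul_one]

open Finset.HasAntidiagonal (antidiagonal mem_antidiagonal)

section Antidiagonal

theorem sum_antidiagonal_antidiagonal_comm {M : Type*} [AddCommMonoid M] (n : ℕ)
    (F : ℕ → ℕ → ℕ → M) :
    ∑ p ∈ antidiagonal n, ∑ q ∈ antidiagonal p.2, F p.1 q.1 q.2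
      = ∑ p ∈ antidiagonal n, ∑ q ∈ antidiagonal p.2, F q.1 p.1 q.2 := by
  simp only [Finset.sum_sigma']
  refine Finset.sum_nbij' (fun x => ⟨(x.2.1, x.1.1 + x.2.2), (x.1.1, x.2.2)⟩)
    (fun x => ⟨(x.2.1, x.1.1 + x.2.2), (x.1.1, x.2.2)⟩) ?_ ?_ ?_ ?_ fun _ _ => rfl
  all_goals
    rintro ⟨⟨c, e⟩, a, b⟩ h
    simp only [Finset.mem_sigma, mem_antidiagonal] at h
    obtain ⟨h, rfl⟩ := h
    grind [mem_antidiagonal]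

variable {K : Type*} [CommRing K]

theorem two_mul_sum_antidiagonal_fst_mul (n : ℕ) {T : ℕ × ℕ → K} (hT : ∀ p, T p.swap = T p) :
    2 * ∑ p ∈ antidiagonal n, (p.1 : K) * T p = n * ∑ p ∈ antidiagonal n, T p := by
  have hswap : ∑ p ∈ antidiagonal n, (p.1 : K) * T p
      = ∑ p ∈ antidiagonal n, (p.2 : K) * T p := by
    rw [← Finset.Nat.sum_antidiagonal_swap]
    exact Finset.sum_congr rfl fun p _ => by rw [hT]; rfl
  rw [two_mul]
  nth_rw 2 [hswap]
  rw [← Finset.sum_add_distrib, Finset.mul_sum]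
  refine Finset.sum_congr rfl fun p hp => ?_
  rw [← mem_antidiagonal.mp hp]
  push_cast
  ring

-- By symmetry each of `a`, `b`, `c` has weighted sum `n / 3` times the plain one.
theorem sum_antidiagonal_antidiagonal_weight_eq_zero (n : ℕ) {F : ℕ → ℕ → ℕ → K}
    (h₁ : ∀ a b c, F a b c = F b a c) (h₂ : ∀ a b c, F a b c = F a c b) :
    ∑ p ∈ antidiagonal n, (3 * (p.1 : K) - n) * ∑ q ∈ antidiagonal p.2, F p.1 q.1 q.2 = 0 := by
  have hcomm : ∑ p ∈ antidiagonal n, (p.1 : K) * ∑ q ∈ antidiagonal p.2, F p.1 q.1 q.2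
      = ∑ p ∈ antidiagonal n, ∑ q ∈ antidiagonal p.2, (q.1 : K) * F p.1 q.1 q.2 := by
    simp only [Finset.mul_sum]
    rw [sum_antidiagonal_antidiagonal_comm n fun c a b => (c : K) * F c a b]
    simp only [h₁]
  have hpair : 2 * ∑ p ∈ antidiagonal n, ∑ q ∈ antidiagonal p.2, (q.1 : K) * F p.1 q.1 q.2
      = ∑ p ∈ antidiagonal n, (p.2 : K) * ∑ q ∈ antidiagonal p.2, F p.1 q.1 q.2 := by
    rw [Finset.mul_sum]
    exact Finset.sum_congr rfl fun p _ =>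
      two_mul_sum_antidiagonal_fst_mul p.2 (T := fun q => F p.1 q.1 q.2) fun q => h₂ _ _ _
  calc ∑ p ∈ antidiagonal n, (3 * (p.1 : K) - n) * ∑ q ∈ antidiagonal p.2, F p.1 q.1 q.2
      = 2 * ∑ p ∈ antidiagonal n, (p.1 : K) * ∑ q ∈ antidiagonal p.2, F p.1 q.1 q.2
        - ∑ p ∈ antidiagonal n, (p.2 : K) * ∑ q ∈ antidiagonal p.2, F p.1 q.1 q.2 := by
        rw [Finset.mul_sum, ← Finset.sum_sub_distrib]
        refine Finset.sum_congr rfl fun p hp => ?_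
        rw [← mem_antidiagonal.mp hp]
        push_cast
        ring
    _ = 0 := by rw [hcomm, hpair, sub_self]

theorem sum_antidiagonal_mul_odd (n : ℕ) :
    2 * ∑ p ∈ antidiagonal n, (3 * (p.1 : K) - n) * (2 * p.1 + 1) = n * (n + 1) * (2 * n + 3) := by
  have h : ∀ m : ℕ, 2 * ∑ a ∈ Finset.range m, (3 * (a : K) - n) * (2 * a + 1)
      = m * (m - 1) * (4 * m + 1) - 2 * n * m ^ 2 := fun m => by
    induction m with
    | zero => simp
    | succ m ih =>
      rw [Finset.sum_range_succ, mul_add, ih]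
      push_cast
      ring
  rw [Finset.Nat.sum_antidiagonal_eq_sum_range_succ_mk, h]
  push_cast
  ring

end Antidiagonal

theorem Z_zero_singleton (c : ℕ) : Z [0, c] = (2 * c + 1 + 1 / 8) * Z [c] := by
  rw [isVirasoro_Z.apply_cons, vir_apply, raise_cons, pairDer_apply]
  simp only [add_zero, raise_nil, one_div, pairs_zero, Finset.sum_empty, mul_zero, ↓reduceIte]
  ring

theorem Z_succ_nil (n : ℕ) :
    Z [n + 1] = 1 / 2 * ∑ p ∈ antidiagonal n, Z [p.1, p.2] := by
  rw [isVirasoro_Z.apply_cons, vir_apply, raise_nil, pairDer_apply, if_neg n.succ_ne_zero]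
  simp [pairs]

theorem Z_succ_singleton (n c : ℕ) :
    Z [n + 1, c] = (2 * c + 1) * Z [c + n + 1]
      + 1 / 2 * ∑ p ∈ antidiagonal n, Z [p.1, p.2, c] := by
  rw [isVirasoro_Z.apply_cons, vir_apply, raise_cons, pairDer_apply, if_neg n.succ_ne_zero]
  simp [pairs, add_assoc]

-- The Virasoro constraint for `Z(e + 1, c)`, weighted by `3 c - n` and summed over `c + e = n`:
-- the three-point numbers drop out by symmetry.
theorem sum_weight_mul_Z_pair (n : ℕ) :
    2 * ∑ p ∈ antidiagonal n, (3 * (p.1 : ℚ) - n) * Z [p.1, p.2 + 1]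
      = n * (n + 1) * (2 * n + 3) * Z [n + 1] := by
  have htriple := sum_antidiagonal_antidiagonal_weight_eq_zero (K := ℚ) n
    (F := fun c a b => Z [a, b, c])
    (fun a b c => symmetric_Z _ _ (by grind)) (fun a b c => symmetric_Z _ _ (by grind))
  have hpair : ∀ p ∈ antidiagonal n,
      (3 * (p.1 : ℚ) - n) * Z [p.1, p.2 + 1]
        = (3 * (p.1 : ℚ) - n) * (2 * p.1 + 1) * Z [n + 1]
          + 1 / 2 * ((3 * (p.1 : ℚ) - n)
            * ∑ q ∈ antidiagonal p.2, Z [q.1, q.2, p.1]) := by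
    intro p hp
    rw [symmetric_Z _ _ (List.Perm.swap _ _ _), Z_succ_singleton, mem_antidiagonal.mp hp]
    ring
  rw [Finset.sum_congr rfl hpair, Finset.sum_add_distrib, ← Finset.sum_mul, ← Finset.mul_sum,
    htriple, mul_zero, add_zero, ← mul_assoc, sum_antidiagonal_mul_odd]

theorem Z_singleton_zero : Z [0] = 1 / 8 := by
  rw [isVirasoro_Z.apply_cons, vir_apply, raise_nil, pairDer_apply]
  simp

theorem Z_singleton_succ (m : ℕ) :
    8 * ((m : ℚ) + 2) * Z [m + 1] = (2 * m + 1) * (2 * m + 3) ^ 2 * Z [m] := by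
  cases m with
  | zero =>
    rw [Z_succ_nil]
    simp only [CharP.cast_eq_zero, zero_add, one_div, Finset.HasAntidiagonal.antidiagonal_zero,
      Finset.sum_singleton, Z_zero_singleton, mul_zero, one_mul]
    ring
  | succ n =>
    have hweight := sum_weight_mul_Z_pair n
    have hsymm := two_mul_sum_antidiagonal_fst_mul (n + 1) (T := fun p => Z [p.1, p.2])
      fun p => symmetric_Z _ _ (List.Perm.swap _ _ _)
    have hlast := Finset.Nat.sum_antidiagonal_succ' (n := n)
      (f := fun p => (3 * (p.1 : ℚ) - n) * Z [p.1, p.2])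
    have hsplit : ∑ p ∈ antidiagonal (n + 1),
          (3 * (p.1 : ℚ) - n) * Z [p.1, p.2]
        = 3 * ∑ p ∈ antidiagonal (n + 1), (p.1 : ℚ) * Z [p.1, p.2]
          - n * ∑ p ∈ antidiagonal (n + 1), Z [p.1, p.2] := by
      rw [Finset.mul_sum, Finset.mul_sum, ← Finset.sum_sub_distrib]
      exact Finset.sum_congr rfl fun p _ => by ring
    have hcorner : Z [n + 1, 0] = (2 * (n + 1) + 1 + 1 / 8) * Z [n + 1] := by
      rw [symmetric_Z _ _ (List.Perm.swap _ _ _), Z_zero_singleton]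
      push_cast
      ring
    have htop := Z_succ_nil (n + 1)
    rw [hcorner] at hlast
    push_cast at hsymm hlast ⊢
    linear_combination 8 * (n + 3 : ℚ) * htop - 12 * hsymm - 8 * hsplit + 8 * hlast + 4 * hweight

/-! ### Shifted times -/

open PowerSeries

local notation "w" => (PowerSeries.X : ℚ⟦X⟧)

section EulerDerivation

/-- The derivation `w d/dw` of `ℚ⟦w⟧`. -/
noncomputable def eulerDer : Derivation ℚ ℚ⟦X⟧ ℚ⟦X⟧ := w • derivative ℚ

theorem eulerDer_apply (f : ℚ⟦X⟧) : eulerDer f = w * derivative ℚ f := rfl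

@[simp] theorem coeff_eulerDer (n : ℕ) (f : ℚ⟦X⟧) : coeff n (eulerDer f) = n * coeff n f := by
  cases n with
  | zero => simp [eulerDer_apply]
  | succ n => rw [eulerDer_apply, coeff_succ_X_mul, coeff_derivative]; push_cast; ring

theorem eulerDer_C (c : ℚ) : eulerDer (PowerSeries.C c) = 0 := by
  rw [eulerDer_apply, derivative_C, mul_zero]

theorem eulerDer_C_mul (c : ℚ) (f : ℚ⟦X⟧) :
    eulerDer (PowerSeries.C c * f) = PowerSeries.C c * eulerDer f := by
  simp [eulerDer_C]

theorem eulerDer_X_pow (n : ℕ) : eulerDer (w ^ n) = n * w ^ n := by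
  ext m
  rw [coeff_eulerDer, ← map_natCast PowerSeries.C n, coeff_C_mul, coeff_X_pow]
  split_ifs with h
  · rw [h]
  · simp

end EulerDerivation

section ShiftSum

/-- The shifts `c_a = 4 ^ (a + 1) w ^ (2 a + 1)` of the times. -/
noncomputable def timeShift (a : ℕ) : ℚ⟦X⟧ := PowerSeries.C (4 ^ (a + 1)) * w ^ (2 * a + 1)

theorem timeShift_zero : timeShift 0 = 4 * w := by
  simp [timeShift, map_ofNat PowerSeries.C 4]

theorem timeShift_mul (a b : ℕ) : timeShift a * timeShift b = 4 * w * timeShift (a + b) := by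
  simp only [timeShift, map_pow, map_ofNat]
  ring

theorem timeShift_succ (a : ℕ) : timeShift (a + 1) = 4 * w ^ 2 * timeShift a := by
  simp only [timeShift, map_pow, map_ofNat]
  ring

theorem eulerDer_timeShift (a : ℕ) : eulerDer (timeShift a) = (2 * a + 1) * timeShift a := by
  rw [timeShift, eulerDer_C_mul, eulerDer_X_pow]
  push_cast
  ring

theorem X_pow_dvd_timeShift {a n : ℕ} (h : n ≤ 2 * a + 1) : w ^ n ∣ timeShift a :=
  (pow_dvd_pow w h).mul_left _

/-- The `w`-adically convergent series `∑_a c_a g_a`. -/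
noncomputable def shiftSum : (ℕ → ℚ⟦X⟧) →ₗ[ℚ] ℚ⟦X⟧ where
  toFun g := mk fun n => ∑ a ∈ Finset.range n, coeff n (timeShift a * g a)
  map_add' g h := by
    ext n
    simp [mul_add, Finset.sum_add_distrib]
  map_smul' c g := by
    ext n
    simp [Finset.mul_sum]

theorem coeff_shiftSum {n N : ℕ} (h : n ≤ 2 * N) (g : ℕ → ℚ⟦X⟧) :
    coeff n (shiftSum g) = ∑ a ∈ Finset.range N, coeff n (timeShift a * g a) := by
  have hzero : ∀ a, n < 2 * a + 1 → coeff n (timeShift a * g a) = 0 := fun a ha =>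
    X_pow_dvd_iff.mp ((X_pow_dvd_timeShift le_rfl).mul_right (g a)) n ha
  have hmono : ∀ m m', m ≤ m' → n ≤ 2 * m → ∑ a ∈ Finset.range m, coeff n (timeShift a * g a)
      = ∑ a ∈ Finset.range m', coeff n (timeShift a * g a) := fun m m' hm hn =>
    Finset.sum_subset (Finset.range_subset_range.mpr hm) fun a _ ha =>
      hzero a (by rw [Finset.mem_range] at ha; omega)
  change coeff n (mk fun n => ∑ a ∈ Finset.range n, coeff n (timeShift a * g a)) = _
  rw [coeff_mk, hmono n (max n N) (le_max_left _ _) (by omega),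
    hmono N (max n N) (le_max_right _ _) h]

theorem X_pow_dvd_shiftSum_sub (g : ℕ → ℚ⟦X⟧) (N : ℕ) :
    w ^ N ∣ shiftSum g - ∑ a ∈ Finset.range N, timeShift a * g a := by
  refine X_pow_dvd_iff.mpr fun n hn => ?_
  rw [map_sub, map_sum, coeff_shiftSum (N := N) (by omega), sub_self]

theorem eq_of_forall_X_pow_dvd_sub {f g : ℚ⟦X⟧} (h : ∀ N, w ^ N ∣ f - g) : f = g := by
  ext n
  rw [← sub_eq_zero, ← map_sub]
  exact X_pow_dvd_iff.mp (h (n + 1)) n n.lt_succ_self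

theorem shiftSum_eq_of_forall_dvd {g : ℕ → ℚ⟦X⟧} {f : ℚ⟦X⟧}
    (h : ∀ N, w ^ N ∣ f - ∑ a ∈ Finset.range N, timeShift a * g a) : shiftSum g = f :=
  eq_of_forall_X_pow_dvd_sub fun N => by
    simpa using (X_pow_dvd_shiftSum_sub g N).sub (h N)

theorem shiftSum_mul (h : ℚ⟦X⟧) (g : ℕ → ℚ⟦X⟧) :
    shiftSum (fun a => h * g a) = h * shiftSum g :=
  shiftSum_eq_of_forall_dvd fun N => by
    have := (X_pow_dvd_shiftSum_sub g N).mul_left h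
    rw [mul_sub, Finset.mul_sum] at this
    simpa only [mul_left_comm] using this

theorem shiftSum_zero_add_succ (g : ℕ → ℚ⟦X⟧) :
    shiftSum g = 4 * w * g 0 + 4 * w ^ 2 * shiftSum fun a => g (a + 1) :=
  shiftSum_eq_of_forall_dvd fun N => by
    cases N with
    | zero => simp
    | succ N =>
      refine (pow_dvd_pow w (show N + 1 ≤ N + 2 by omega)).trans ?_
      rw [Finset.sum_range_succ', pow_add, timeShift_zero]
      simp only [timeShift_succ, mul_assoc (4 * w ^ 2), ← Finset.mul_sum]
      obtain ⟨q, hq⟩ := X_pow_dvd_shiftSum_sub (fun a => g (a + 1)) N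
      exact ⟨4 * q, by linear_combination 4 * w ^ 2 * hq⟩

theorem X_dvd_shiftSum (g : ℕ → ℚ⟦X⟧) : w ∣ shiftSum g := by
  rw [shiftSum_zero_add_succ, pow_two]
  exact dvd_add ⟨4 * g 0, by ring⟩ ⟨4 * w * shiftSum fun a => g (a + 1), by ring⟩

theorem X_pow_succ_dvd_shiftSum {k : ℕ} {g : ℕ → ℚ⟦X⟧} (h : ∀ a, w ^ k ∣ g a) :
    w ^ (k + 1) ∣ shiftSum g := by
  choose q hq using h
  rw [funext hq, shiftSum_mul, pow_succ]
  exact mul_dvd_mul_left _ (X_dvd_shiftSum q)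

theorem eulerDer_shiftSum (g : ℕ → ℚ⟦X⟧) :
    eulerDer (shiftSum g) = shiftSum (fun a => (2 * a + 1) * g a)
      + shiftSum fun a => eulerDer (g a) := by
  ext n
  rw [coeff_eulerDer, map_add]
  simp only [coeff_shiftSum (show n ≤ 2 * n by omega)]
  rw [Finset.mul_sum, ← Finset.sum_add_distrib]
  refine Finset.sum_congr rfl fun a _ => ?_
  rw [← coeff_eulerDer, eulerDer.leibniz, eulerDer_timeShift, ← map_add]
  congr 1
  simp only [smul_eq_mul]
  ring

theorem shiftSum_shiftSum (g : ℕ → ℕ → ℚ⟦X⟧) :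
    shiftSum (fun a => shiftSum (g a))
      = 4 * w * shiftSum fun e => ∑ p ∈ Finset.HasAntidiagonal.antidiagonal e, g p.1 p.2 := by
  refine shiftSum_eq_of_forall_dvd fun N => ?_
  have houter := (X_pow_dvd_shiftSum_sub
    (fun e => ∑ p ∈ Finset.HasAntidiagonal.antidiagonal e, g p.1 p.2) N).mul_left (4 * w)
  have hinner : w ^ N ∣ ∑ a ∈ Finset.range N, timeShift a
      * (shiftSum (g a) - ∑ b ∈ Finset.range (N - a), timeShift b * g a b) :=
    Finset.dvd_sum fun a ha => by
      rw [Finset.mem_range] at ha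
      rw [show N = a + (N - a) by omega, pow_add, Nat.add_sub_cancel_left]
      exact mul_dvd_mul (X_pow_dvd_timeShift (by omega)) (X_pow_dvd_shiftSum_sub (g a) _)
  have hdiag : 4 * w * ∑ e ∈ Finset.range N, timeShift e
        * ∑ p ∈ Finset.HasAntidiagonal.antidiagonal e, g p.1 p.2
      = ∑ a ∈ Finset.range N, ∑ b ∈ Finset.range (N - a),
          timeShift a * (timeShift b * g a b) := by
    rw [← Finset.sum_range_diag_flip N fun a b => timeShift a * (timeShift b * g a b),
      Finset.mul_sum]
    refine Finset.sum_congr rfl fun e _ => ?_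
    rw [← Finset.Nat.sum_antidiagonal_eq_sum_range_succ
      (fun a b => timeShift a * (timeShift b * g a b)), ← mul_assoc, Finset.mul_sum]
    refine Finset.sum_congr rfl fun p hp => ?_
    rw [← mul_assoc, timeShift_mul, Finset.HasAntidiagonal.mem_antidiagonal.mp hp]
  convert houter.sub hinner using 1
  rw [mul_sub, hdiag]
  simp only [mul_sub, Finset.mul_sum, Finset.sum_sub_distrib]
  ring

theorem shiftSum_comm (g : ℕ → ℕ → ℚ⟦X⟧) :
    shiftSum (fun a => shiftSum fun b => g a b) = shiftSum fun b => shiftSum fun a => g a b := by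
  rw [shiftSum_shiftSum, shiftSum_shiftSum]
  congr 2
  ext1 e
  exact (Finset.Nat.sum_antidiagonal_swap (f := fun p => g p.1 p.2)).symm

end ShiftSum

namespace Shuffle

section Map

variable {α K K' : Type*} [CommRing K] [CommRing K']

/-- Postcomposition with an additive map. -/
def map (ρ : K →+ K') (f : Shuffle α K) : Shuffle α K' := ⟨fun l => ρ (f l)⟩

@[simp] theorem map_apply (ρ : K →+ K') (f : Shuffle α K) (l : List α) :
    map ρ f l = ρ (f l) := rfl

theorem der_map (ρ : K →+ K') (a : α) (f : Shuffle α K) : der a (map ρ f) = map ρ (der a f) := rfl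

/-- The function with constant value `1`. -/
def ones : Shuffle α K := ⟨fun _ => 1⟩

@[simp] theorem ones_apply (l : List α) : (ones : Shuffle α K) l = 1 := rfl

/-- The sum of `f` over all subfamilies, counted by positions. -/
def subsum (f : Shuffle α K) : Shuffle α K := ones * f

@[simp] theorem subsum_nil (f : Shuffle α K) : subsum f [] = f [] := by simp [subsum]

theorem subsum_cons (f : Shuffle α K) (a : α) (l : List α) :
    subsum f (a :: l) = subsum f l + subsum (der a f) l := mul_cons _ _ _ _

theorem map_subsum (ρ : K →+ K') (f : Shuffle α K) : map ρ (subsum f) = subsum (map ρ f) := by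
  ext l
  induction l generalizing f with
  | nil => simp
  | cons a l ih =>
    have hder := ih (der a f)
    have hrest := ih f
    rw [map_apply] at hder hrest
    rw [map_apply, subsum_cons, subsum_cons, _root_.map_add, hrest, hder, der_map]

theorem raise_map (ρ : K →+ K') (d : ℕ) (f : Shuffle ℕ K) :
    raise d (map ρ f) = map ρ (raise d f) := by
  ext l
  simp only [map_apply, raise_apply, map_sum]
  refine Finset.sum_congr rfl fun i _ => ?_
  have hnsmul := map_nsmul ρ (2 * l.get i + 1) (f (l.set i (l.get i + d)))
  simpa only [nsmul_eq_mul, Nat.cast_add, Nat.cast_mul, Nat.cast_ofNat, Nat.cast_one]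
    using hnsmul.symm

theorem vir_map {u v : K} {u' v' : K'} (ρ : K →+ K') (hu : ∀ x, ρ (u * x) = u' * ρ x)
    (hv : ∀ x, ρ (v * x) = v' * ρ x) (d : ℕ) (f : Shuffle ℕ K) :
    vir u' v' d (map ρ f) = map ρ (vir u v d f) := by
  ext l
  rw [map_apply, vir_apply, vir_apply, raise_map, pairDer_apply, pairDer_apply, _root_.map_add,
    _root_.map_add, hu, map_sum]
  congr 1
  split_ifs
  · rw [hv, map_apply]
  · simp

end Map

end Shuffle

section ShiftedNumbers

/-- Termwise convergent series `∑_a c_a F_a`. -/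
noncomputable def shiftSeries (F : ℕ → Shuffle ℕ ℚ⟦X⟧) : Shuffle ℕ ℚ⟦X⟧ :=
  ⟨fun l => shiftSum fun a => F a l⟩

theorem shiftSeries_apply (F : ℕ → Shuffle ℕ ℚ⟦X⟧) (l : List ℕ) :
    shiftSeries F l = shiftSum fun a => F a l := rfl

theorem raise_shiftSeries (d : ℕ) (F : ℕ → Shuffle ℕ ℚ⟦X⟧) :
    raise d (shiftSeries F) = shiftSeries fun a => raise d (F a) := by
  ext1 l
  rw [shiftSeries_apply, raise_apply]
  simp only [raise_apply, shiftSeries_apply]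
  rw [← Finset.sum_fn, map_sum]
  exact Finset.sum_congr rfl fun i _ => (shiftSum_mul _ _).symm

theorem vir_shiftSeries (u v : ℚ⟦X⟧) (d : ℕ) (F : ℕ → Shuffle ℕ ℚ⟦X⟧) :
    vir u v d (shiftSeries F) = shiftSeries fun a => vir u v d (F a) := by
  ext1 l
  have hpair : pairDer d (shiftSeries F) l = shiftSum fun a => pairDer d (F a) l := by
    simp only [pairDer_apply, shiftSeries_apply]
    rw [← Finset.sum_fn, map_sum]
  rw [vir_apply, raise_shiftSeries, hpair, shiftSeries_apply, shiftSeries_apply,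
    shiftSeries_apply, ← shiftSum_mul, ← shiftSum_mul, ← map_add, ← map_add]
  rfl

/-- The operator `w d/dw + ∑_a c_a ∂_a`. Its kernel consists of the families obtained from their
values at `w = 0` by subtracting the shifts `c_a / (2 a + 1)` from the times. -/
noncomputable def flow (f : Shuffle ℕ ℚ⟦X⟧) : Shuffle ℕ ℚ⟦X⟧ :=
  Shuffle.map eulerDer f + shiftSeries fun a => der a f

theorem flow_apply (f : Shuffle ℕ ℚ⟦X⟧) (l : List ℕ) :
    flow f l = eulerDer (f l) + shiftSum fun a => f (a :: l) := rfl

theorem eq_zero_of_flow_eq_zero {f : Shuffle ℕ ℚ⟦X⟧} (hf : flow f = 0)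
    (h0 : ∀ l, constantCoeff (f l) = 0) : f = 0 := by
  have hdvd : ∀ k l, w ^ k ∣ f l := fun k => by
    induction k with
    | zero => exact fun l => one_dvd _
    | succ k ih =>
      intro l
      have hl : eulerDer (f l) = -shiftSum fun a => f (a :: l) :=
        eq_neg_of_add_eq_zero_left (DFunLike.congr_fun hf l)
      refine X_pow_dvd_iff.mpr fun n hn => ?_
      have hn' := X_pow_dvd_iff.mp (X_pow_succ_dvd_shiftSum fun a => ih (a :: l)) n hn
      rcases n.eq_zero_or_pos with rfl | hpos
      · rw [coeff_zero_eq_constantCoeff_apply, h0]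
      · have := congrArg (coeff n) hl
        rw [coeff_eulerDer, map_neg, hn', neg_zero] at this
        exact (mul_eq_zero.mp this).resolve_left (by positivity)
  ext1 l
  exact eq_of_forall_X_pow_dvd_sub fun N => by simpa using hdvd N l

/-- The defect of the Virasoro constraints for the shifted times. -/
noncomputable def shiftedVir (d : ℕ) (f : Shuffle ℕ ℚ⟦X⟧) : Shuffle ℕ ℚ⟦X⟧ :=
  vir (PowerSeries.C (1 / 2)) (PowerSeries.C (1 / 8)) d f - der d f
    - shiftSeries fun c => der (c + d) f

theorem shiftedVir_apply (d : ℕ) (f : Shuffle ℕ ℚ⟦X⟧) (l : List ℕ) :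
    shiftedVir d f l = vir (PowerSeries.C (1 / 2)) (PowerSeries.C (1 / 8)) d f l - f (d :: l)
      - shiftSum fun c => f ((c + d) :: l) := rfl

-- Both `w d/dw`, acting on the coefficients `c_c` of `∑_c c_c ∂_{c + d}`, and the commutators
-- `[∂_a, N_d] = (2 a + 1) ∂_{a + d}` produce `∑_a (2 a + 1) c_a ∂_{a + d}`, with opposite signs.
theorem flow_shiftedVir {f : Shuffle ℕ ℚ⟦X⟧} (hf : Symmetric f) (d : ℕ) :
    flow (shiftedVir d f) = shiftedVir d (flow f) := by
  have hvir : vir (PowerSeries.C (1 / 2)) (PowerSeries.C (1 / 8)) d (flow f)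
      = Shuffle.map eulerDer (vir (PowerSeries.C (1 / 2)) (PowerSeries.C (1 / 8)) d f)
        + shiftSeries fun a => vir (PowerSeries.C (1 / 2)) (PowerSeries.C (1 / 8)) d (der a f) := by
    rw [flow, map_add, vir_shiftSeries]
    congr 1
    exact vir_map _ (eulerDer_C_mul _) (eulerDer_C_mul _) d f
  ext1 l
  have hder : (fun a => shiftedVir d f (a :: l)) = fun a =>
      (2 * a + 1) * f ((a + d) :: l)
        + vir (PowerSeries.C (1 / 2)) (PowerSeries.C (1 / 8)) d (der a f) l
        - f (d :: a :: l) - shiftSum fun c => f ((c + d) :: a :: l) := by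
    ext1 a
    rw [shiftedVir_apply, ← der_apply a (vir _ _ d f), hf.der_vir]
    rfl
  have hcomm : (shiftSum fun a => shiftSum fun c => f ((c + d) :: a :: l))
      = shiftSum fun c => shiftSum fun a => f (a :: (c + d) :: l) := by
    rw [shiftSum_comm]
    simp only [hf _ _ (List.Perm.swap _ _ l)]
  have hswap : (shiftSum fun a => f (d :: a :: l)) = shiftSum fun a => f (a :: d :: l) := by
    simp only [hf _ _ (List.Perm.swap d _ l)]
  rw [flow_apply, hder, shiftedVir_apply, shiftedVir_apply, hvir, map_sub, map_sub,
    eulerDer_shiftSum]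
  simp only [Shuffle.add_apply, map_apply, shiftSeries_apply, flow_apply]
  simp only [← Pi.sub_def, ← Pi.add_def, map_sub, map_add]
  rw [hcomm, hswap, AddMonoidHom.coe_coe]
  ring

/-- The coefficient of `w ^ N` in the shifted number with insertions `l`. -/
def shiftedCoeff : ℕ → List ℕ → ℚ
  | 0, l => Z l
  | N + 1, l => -4 / (N + 1) * ∑ a : Fin (N / 2 + 1),
      4 ^ (a : ℕ) * shiftedCoeff (N - 2 * a) (a :: l)

/-- The disconnected numbers `Z` after the shift of the times that `flow` generates, as power
series in `w`. -/
noncomputable def S : Shuffle ℕ ℚ⟦X⟧ := ⟨fun l => PowerSeries.mk fun N => shiftedCoeff N l⟩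

@[simp] theorem coeff_S (N : ℕ) (l : List ℕ) : coeff N (S l) = shiftedCoeff N l :=
  PowerSeries.coeff_mk N fun N => shiftedCoeff N l

theorem map_constantCoeff_S : Shuffle.map (constantCoeff : ℚ⟦X⟧ →+* ℚ).toAddMonoidHom S = Z := by
  ext l
  change constantCoeff (S l) = Z l
  rw [← coeff_zero_eq_constantCoeff_apply, coeff_S, shiftedCoeff]

theorem flow_S : flow S = 0 := by
  ext1 l
  ext N
  rw [flow_apply, Shuffle.zero_apply, map_zero, map_add, coeff_eulerDer, coeff_S]
  cases N with
  | zero => simp [coeff_shiftSum (N := 0) le_rfl]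
  | succ N =>
    rw [coeff_shiftSum (N := N / 2 + 1) (by omega), shiftedCoeff, Finset.sum_range]
    have hcoeff : ∀ a : Fin (N / 2 + 1), coeff (N + 1) (timeShift a * S ((a : ℕ) :: l))
        = 4 * (4 ^ (a : ℕ) * shiftedCoeff (N - 2 * a) (a :: l)) := fun a => by
      rw [timeShift, mul_assoc, coeff_C_mul, coeff_X_pow_mul', if_pos (by omega), coeff_S,
        Nat.add_sub_add_right]
      ring
    rw [Finset.sum_congr rfl fun a _ => hcoeff a, ← Finset.mul_sum]
    push_cast
    field_simp
    ring

theorem symmetric_S : Symmetric S := by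
  suffices ∀ N l l', l.Perm l' → shiftedCoeff N l = shiftedCoeff N l' from
    fun l l' h => PowerSeries.ext fun N => by rw [coeff_S, coeff_S, this N l l' h]
  intro N
  induction N using Nat.strong_induction_on with
  | _ N ih =>
    intro l l' h
    cases N with
    | zero => rw [shiftedCoeff, shiftedCoeff, symmetric_Z l l' h]
    | succ N =>
      rw [shiftedCoeff, shiftedCoeff]
      congr 1
      exact Finset.sum_congr rfl fun a _ => by
        rw [ih (N - 2 * a) (by omega) _ _ (h.cons (a : ℕ))]

theorem shiftedVir_S (d : ℕ) : shiftedVir d S = 0 := by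
  refine eq_zero_of_flow_eq_zero ?_ fun l => ?_
  · rw [flow_shiftedVir symmetric_S, flow_S]
    ext1 l
    rw [shiftedVir_apply, map_zero, Shuffle.zero_apply, Shuffle.zero_apply, sub_zero, zero_sub,
      neg_eq_zero]
    exact map_zero shiftSum
  · have hvir := vir_map (constantCoeff : ℚ⟦X⟧ →+* ℚ).toAddMonoidHom
      (u := PowerSeries.C (1 / 2)) (v := PowerSeries.C (1 / 8)) (u' := 1 / 2) (v' := 1 / 8)
      (by simp) (by simp) d S
    have hshift := X_dvd_iff.mp (X_dvd_shiftSum fun c => S ((c + d) :: l))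
    rw [map_constantCoeff_S, ← isVirasoro_Z d, ← map_constantCoeff_S, der_map] at hvir
    rw [shiftedVir_apply, map_sub, map_sub, hshift, sub_zero, sub_eq_zero]
    exact (DFunLike.congr_fun hvir l).symm

theorem S_cons (d : ℕ) (l : List ℕ) :
    S (d :: l) + shiftSum (fun c => S ((c + d) :: l))
      = vir (PowerSeries.C (1 / 2)) (PowerSeries.C (1 / 8)) d S l := by
  have := DFunLike.congr_fun (shiftedVir_S d) l
  rw [shiftedVir_apply, Shuffle.zero_apply] at this
  linear_combination -this

theorem eulerDer_S (l : List ℕ) : eulerDer (S l) = -shiftSum fun a => S (a :: l) :=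
  eq_neg_of_add_eq_zero_left (DFunLike.congr_fun flow_S l)

end ShiftedNumbers

section NoInsertions

theorem vir_nil (u v : ℚ⟦X⟧) (d : ℕ) (f : Shuffle ℕ ℚ⟦X⟧) :
    vir u v d f [] = u * ∑ p ∈ pairs d, f [p.1, p.2] + (if d = 0 then v else 0) * f [] := by
  rw [vir_apply, raise_nil, zero_add, pairDer_apply]

theorem two_mul_shiftSum_mul_S_singleton (r : ℕ → ℚ⟦X⟧) :
    2 * shiftSum (fun d => r d * S [d])
        + 8 * w * shiftSum (fun e => (∑ d ∈ Finset.range (e + 1), r d) * S [e])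
      = 4 * w ^ 2 * shiftSum (fun e => r (e + 1) * ∑ p ∈ antidiagonal e, S [p.1, p.2])
        + w * r 0 * S [] := by
  have hconv : (shiftSum fun d => r d * shiftSum fun c => S [c + d])
      = 4 * w * shiftSum fun e => (∑ d ∈ Finset.range (e + 1), r d) * S [e] := by
    have := shiftSum_shiftSum fun d c => r d * S [c + d]
    simp only [shiftSum_mul] at this
    rw [this]
    congr 2
    ext1 e
    rw [Finset.sum_mul, ← Finset.Nat.sum_antidiagonal_eq_sum_range_succ fun d _ => r d * S [e]]
    exact Finset.sum_congr rfl fun p hp => by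
      rw [add_comm, Finset.HasAntidiagonal.mem_antidiagonal.mp hp]
  have hvir : shiftSum (fun d => r d * S [d])
        + shiftSum (fun d => r d * shiftSum fun c => S [c + d])
      = shiftSum fun d => r d * vir (PowerSeries.C (1 / 2)) (PowerSeries.C (1 / 8)) d S [] := by
    rw [← map_add]
    congr 1
    ext1 d
    rw [← S_cons]
    exact (mul_add _ _ _).symm
  have hsplit : (shiftSum fun d => r d
        * vir (PowerSeries.C (1 / 2)) (PowerSeries.C (1 / 8)) d S [])
      = 4 * w * (r 0 * (PowerSeries.C (1 / 8) * S [])) + 4 * w ^ 2 * (PowerSeries.C (1 / 2)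
        * shiftSum fun e => r (e + 1) * ∑ p ∈ antidiagonal e, S [p.1, p.2]) := by
    rw [shiftSum_zero_add_succ, ← shiftSum_mul (PowerSeries.C (1 / 2))]
    simp [vir_nil, pairs, mul_left_comm]
  have hhalf : (2 : ℚ⟦X⟧) * PowerSeries.C (1 / 2) = 1 := by
    rw [← map_ofNat PowerSeries.C 2, ← map_mul]; norm_num
  have height : (8 : ℚ⟦X⟧) * PowerSeries.C (1 / 8) = 1 := by
    rw [← map_ofNat PowerSeries.C 8, ← map_mul]; norm_num
  linear_combination 2 * hvir - 2 * hconv + 2 * hsplit + w * r 0 * S [] * height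
    + 4 * w ^ 2 * (shiftSum fun e => r (e + 1) * ∑ p ∈ antidiagonal e, S [p.1, p.2]) * hhalf

theorem eulerDer_shiftSum_mul_S_singleton (r : ℕ → ℕ) :
    eulerDer (shiftSum fun a => r a * S [a])
      = shiftSum (fun a => (2 * a + 1) * (r a * S [a]))
        - 4 * w * shiftSum fun e => ∑ p ∈ antidiagonal e, r p.1 * S [p.1, p.2] := by
  have hder : ∀ a,
      eulerDer ((r a : ℚ⟦X⟧) * S [a]) = -shiftSum fun b => r a * S [a, b] := fun a => by
    rw [shiftSum_mul, ← nsmul_eq_mul, map_nsmul, eulerDer_S, nsmul_eq_mul, mul_neg]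
    simp only [symmetric_S _ _ (List.Perm.swap a _ [])]
  have hdouble := shiftSum_shiftSum fun a b => r a * S [a, b]
  rw [eulerDer_shiftSum, ← hdouble, sub_eq_add_neg, ← map_neg]
  simp only [hder, Pi.neg_def]

theorem two_mul_shiftSum_S_singleton :
    2 * shiftSum (fun d => S [d])
        + 4 * w * (shiftSum (fun d => (2 * d + 1) * S [d]) + shiftSum fun d => S [d])
      = 4 * w ^ 2 * shiftSum (fun e => ∑ p ∈ antidiagonal e, S [p.1, p.2]) + w * S [] := by
  have h := two_mul_shiftSum_mul_S_singleton fun _ => 1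
  have hsum : 2 * shiftSum (fun e => (∑ _d ∈ Finset.range (e + 1), (1 : ℚ⟦X⟧)) * S [e])
      = shiftSum (fun d => (2 * d + 1) * S [d]) + shiftSum fun d => S [d] := by
    rw [← shiftSum_mul, ← map_add]
    congr 1
    ext1 e
    simp only [Finset.sum_const, Finset.card_range, nsmul_eq_mul, Pi.add_apply]
    push_cast
    ring
  simp only [one_mul] at h
  linear_combination h - 4 * w * hsum

theorem two_mul_shiftSum_odd_mul_S_singleton :
    2 * shiftSum (fun d => (2 * d + 1) * S [d])
        + 2 * w * (shiftSum (fun d => (2 * d + 1) ^ 2 * S [d])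
          + 2 * shiftSum (fun d => (2 * d + 1) * S [d]) + shiftSum fun d => S [d])
      = 4 * w ^ 2 * (2 * shiftSum (fun e => (e + 1) * ∑ p ∈ antidiagonal e, S [p.1, p.2])
          + shiftSum fun e => ∑ p ∈ antidiagonal e, S [p.1, p.2]) + w * S [] := by
  have h := two_mul_shiftSum_mul_S_singleton fun d => 2 * d + 1
  have hsq : ∀ e : ℕ, ∑ d ∈ Finset.range e, (2 * (d : ℚ⟦X⟧) + 1) = e ^ 2 := fun e => by
    induction e with
    | zero => simp
    | succ e ih => rw [Finset.sum_range_succ, ih]; push_cast; ring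
  have hsum : 4 * shiftSum (fun e => (∑ d ∈ Finset.range (e + 1), (2 * (d : ℚ⟦X⟧) + 1)) * S [e])
      = shiftSum (fun d => (2 * d + 1) ^ 2 * S [d])
          + 2 * shiftSum (fun d => (2 * d + 1) * S [d]) + shiftSum fun d => S [d] := by
    simp only [hsq]
    rw [← shiftSum_mul, ← shiftSum_mul, ← map_add, ← map_add]
    congr 1
    ext1 e
    simp only [Pi.add_apply]
    push_cast
    ring
  have hpair : shiftSum (fun e => (2 * ((e + 1 : ℕ) : ℚ⟦X⟧) + 1)
        * ∑ p ∈ antidiagonal e, S [p.1, p.2])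
      = 2 * shiftSum (fun e => (e + 1) * ∑ p ∈ antidiagonal e, S [p.1, p.2])
          + shiftSum fun e => ∑ p ∈ antidiagonal e, S [p.1, p.2] := by
    rw [← shiftSum_mul, ← map_add]
    congr 1
    ext1 e
    simp only [Pi.add_apply]
    push_cast
    ring
  simp only [Nat.cast_zero] at h
  linear_combination h - 2 * w * hsum + 4 * w ^ 2 * hpair

theorem S_nil_equation {y : ℚ⟦X⟧}
    (hy : y = 2 * eulerDer (S [])
      + w * (4 * eulerDer (S []) + eulerDer (eulerDer (S [])) + S [])) :
    y + w * (eulerDer y - y) = -3 * (w * (eulerDer (S []) + w * eulerDer (S []))) := by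
  have h₀ := two_mul_shiftSum_S_singleton
  have h₁ := two_mul_shiftSum_odd_mul_S_singleton
  have hs : eulerDer (S []) = -shiftSum fun a => S [a] := eulerDer_S []
  have hα := eulerDer_shiftSum_mul_S_singleton fun _ => 1
  have hP := eulerDer_shiftSum_mul_S_singleton fun a => 2 * a + 1
  have hsym : ∀ e : ℕ, ∑ p ∈ antidiagonal e, (2 * (p.1 : ℚ⟦X⟧) + 1) * S [p.1, p.2]
      = (e + 1) * ∑ p ∈ antidiagonal e, S [p.1, p.2] := fun e => by
    have := two_mul_sum_antidiagonal_fst_mul (T := fun p => S [p.1, p.2]) e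
      (fun p => symmetric_S _ _ (List.Perm.swap p.1 p.2 []))
    simp only [add_mul, one_mul, Finset.sum_add_distrib, mul_assoc, ← Finset.mul_sum]
    linear_combination this
  push_cast at hα hP
  simp only [hsym, one_mul, ← mul_assoc, ← pow_two] at hα hP
  set α := shiftSum fun a => S [a]
  set P := shiftSum fun a => (2 * a + 1) * S [a]
  have hPα : P + w * eulerDer P = α + w * α := by
    have := algebraRat.charZero ℚ⟦X⟧
    refine mul_left_cancel₀ two_ne_zero ?_
    linear_combination h₁ - h₀ + 2 * w * hP
  have hyP : y = 3 * (w * P) := by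
    rw [hs, map_neg, hα] at hy
    linear_combination hy - h₀
  have hθ : eulerDer (w * P) = w * P + w * eulerDer P := by
    rw [eulerDer.leibniz, ← pow_one w, eulerDer_X_pow]
    simp only [smul_eq_mul, pow_one, Nat.cast_one]
    ring
  have hθy : eulerDer y = 3 * (w * P + w * eulerDer P) := by
    rw [hyP, ← hθ, show (3 : ℚ⟦X⟧) = PowerSeries.C 3 from (map_ofNat _ 3).symm, eulerDer_C_mul]
  rw [hθy, hyP, hs]
  linear_combination 3 * w * hPα

theorem S_nil_recurrence (n : ℕ) :
    2 * ((n : ℚ) + 2) * coeff (n + 2) (S [])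
      + (3 * ((n : ℚ) + 1) ^ 2 + 5 * (n + 1) + 1) * coeff (n + 1) (S [])
      + n * (n + 2) ^ 2 * coeff n (S []) = 0 := by
  have hX : ∀ (k : ℕ) (f : ℚ⟦X⟧), coeff (k + 1) (w * f) = coeff k f := fun k f =>
    coeff_succ_X_mul k f
  have hnum : ∀ (k c : ℕ) (f : ℚ⟦X⟧), coeff k ((c : ℚ⟦X⟧) * f) = c * coeff k f := fun k c f => by
    rw [← nsmul_eq_mul, map_nsmul, nsmul_eq_mul]
  obtain ⟨y, hy⟩ : ∃ y, y = ((2 : ℕ) : ℚ⟦X⟧) * eulerDer (S [])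
      + w * (((4 : ℕ) : ℚ⟦X⟧) * eulerDer (S []) + eulerDer (eulerDer (S [])) + S []) := ⟨_, rfl⟩
  have hcoeff : ∀ k, coeff (k + 1) y = 2 * (k + 1) * coeff (k + 1) (S [])
      + (4 * k + k ^ 2 + 1) * coeff k (S []) := fun k => by
    rw [hy, map_add, hX, map_add, map_add, hnum, hnum]
    simp only [coeff_eulerDer]
    push_cast
    ring
  have h := congrArg (coeff (n + 2)) (S_nil_equation (by simpa using hy))
  rw [map_add, hX, map_sub, coeff_eulerDer, neg_mul, map_neg, show (3 : ℚ⟦X⟧) = (3 : ℕ) by simp,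
    hnum, hX, map_add, hX, coeff_eulerDer, coeff_eulerDer, hcoeff, hcoeff] at h
  push_cast at h
  linear_combination h

theorem coeff_zero_S_nil : coeff 0 (S []) = 1 := by
  rw [coeff_S, shiftedCoeff, Z_nil]

theorem coeff_one_S_nil : coeff 1 (S []) = -1 / 2 := by
  rw [coeff_S, shiftedCoeff]
  norm_num [shiftedCoeff, Z_singleton_zero]

end NoInsertions

/-! ### Amplitudes -/

namespace Shuffle

section Twist

variable {α K K' : Type*} [CommRing K] [CommRing K']

theorem map_ringHom_mul (ρ : K →+* K') (f g : Shuffle α K) :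
    map ρ.toAddMonoidHom (f * g) = map ρ.toAddMonoidHom f * map ρ.toAddMonoidHom g := by
  ext l
  induction l generalizing f g with
  | nil => exact map_mul ρ _ _
  | cons a l ih =>
    rw [mul_cons, map_apply, mul_cons, RingHom.toAddMonoidHom_eq_coe, _root_.map_add]
    exact congrArg₂ (· + ·) (ih (der a f) g) (ih f (der a g))

theorem map_derivation_mul {R : Type*} [CommRing R] [Algebra R K] (δ : Derivation R K K)
    (f g : Shuffle α K) :
    map (δ : K →+ K) (f * g) = map (δ : K →+ K) f * g + f * map (δ : K →+ K) g := by
  ext l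
  induction l generalizing f g with
  | nil =>
    rw [Shuffle.add_apply, map_apply, mul_nil, mul_nil, mul_nil, map_apply, map_apply,
      AddMonoidHom.coe_coe, δ.leibniz, smul_eq_mul, smul_eq_mul]
    ring
  | cons a l ih =>
    have h₁ := ih (der a f) g
    have h₂ := ih f (der a g)
    simp only [Shuffle.add_apply, map_apply, mul_cons, der_map, _root_.map_add] at h₁ h₂ ⊢
    rw [h₁, h₂]
    ring

/-- Multiplication of the value at a word by the product of the weights `χ` of its letters. -/
def twist (χ : α → K) (f : Shuffle α K) : Shuffle α K := ⟨fun l => (l.map χ).prod * f l⟩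

theorem twist_apply (χ : α → K) (f : Shuffle α K) (l : List α) :
    twist χ f l = (l.map χ).prod * f l := rfl

@[simp] theorem twist_nil (χ : α → K) (f : Shuffle α K) : twist χ f [] = f [] := one_mul _

theorem der_twist (χ : α → K) (a : α) (f : Shuffle α K) :
    der a (twist χ f) = χ a • twist χ (der a f) := by
  ext l
  rw [der_apply, twist_apply, List.map_cons, List.prod_cons, mul_assoc]
  rfl

theorem twist_mul (χ : α → K) (f g : Shuffle α K) :
    twist χ (f * g) = twist χ f * twist χ g := by
  ext l
  induction l generalizing f g with
  | nil => simp
  | cons a l ih =>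
    rw [mul_cons, der_twist, der_twist, smul_mul_assoc, mul_smul_comm, Shuffle.smul_apply,
      Shuffle.smul_apply, ← ih, ← ih, twist_apply, mul_cons, List.map_cons, List.prod_cons]
    simp only [twist_apply]
    ring

theorem Symmetric.twist {f : Shuffle α K} (hf : Symmetric f) (χ : α → K) :
    Symmetric (twist χ f) := fun l l' h => by
  rw [twist_apply, twist_apply, (h.map χ).prod_eq, hf l l' h]

theorem Symmetric.map {f : Shuffle α K} (hf : Symmetric f) (ρ : K →+ K') :
    Symmetric (map ρ f) := fun l l' h => by
  rw [map_apply, map_apply, hf l l' h]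

theorem raise_twist {χ : ℕ → K} {d : ℕ} {c : K} (hχ : ∀ e, χ (e + d) = c * χ e)
    (f : Shuffle ℕ K) : raise d (twist χ f) = c • twist χ (raise d f) := by
  ext l
  induction l generalizing f with
  | nil => simp
  | cons e l ih =>
    rw [raise_cons, der_twist, map_smul, Shuffle.smul_apply, ih, Shuffle.smul_apply,
      Shuffle.smul_apply, twist_apply, twist_apply, twist_apply, raise_cons, List.map_cons,
      List.map_cons, List.prod_cons, List.prod_cons, hχ]
    ring

theorem raise_zero_apply (f : Shuffle ℕ K) (l : List ℕ) : raise 0 f l = X l * f l := by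
  induction l generalizing f with
  | nil => simp [X]
  | cons e l ih =>
    rw [raise_cons, ih, X_cons, der_apply, add_zero]
    push_cast
    ring

end Twist

end Shuffle

section Amplitudes

/-- The weight of an insertion in the expansion parameter `w`. -/
noncomputable def timeWeight (a : ℕ) : ℚ⟦X⟧ := PowerSeries.C (4 ^ a) * w ^ (2 * a + 1)

theorem timeShift_eq (a : ℕ) : timeShift a = 4 * timeWeight a := by
  rw [timeShift, timeWeight, pow_succ', map_mul, map_ofNat, mul_assoc]

theorem timeWeight_add (e d : ℕ) :
    timeWeight (e + d) = PowerSeries.C (4 ^ d) * w ^ (2 * d) * timeWeight e := by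
  simp only [timeWeight, map_pow]
  ring

theorem timeWeight_eq (d : ℕ) : timeWeight d = w * (PowerSeries.C (4 ^ d) * w ^ (2 * d)) := by
  rw [timeWeight]
  ring

theorem eulerDer_timeWeight_prod (l : List ℕ) :
    eulerDer (l.map timeWeight).prod = X l * (l.map timeWeight).prod := by
  induction l with
  | nil => simp [X]
  | cons a l ih =>
    rw [List.map_cons, List.prod_cons, eulerDer.leibniz, ih, timeWeight, eulerDer_C_mul,
      eulerDer_X_pow, X_cons]
    simp only [smul_eq_mul]
    push_cast
    ring

theorem X_pow_dvd_timeWeight_prod (l : List ℕ) : w ^ X l ∣ (l.map timeWeight).prod := by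
  induction l with
  | nil => simp [X]
  | cons a l ih =>
    rw [List.map_cons, List.prod_cons, X_cons, pow_add]
    exact mul_dvd_mul (Dvd.intro_left _ rfl) ih

theorem shiftSum_eq_sum_add (g : ℕ → ℚ⟦X⟧) (d : ℕ) :
    shiftSum g = ∑ a ∈ Finset.range d, timeShift a * g a
      + PowerSeries.C (4 ^ d) * w ^ (2 * d) * shiftSum fun c => g (c + d) := by
  induction d with
  | zero => simp
  | succ d ih =>
    rw [ih, shiftSum_zero_add_succ fun c => g (c + d), Finset.sum_range_succ, timeShift_eq d,
      timeWeight_eq, pow_succ (4 : ℚ), map_mul, map_ofNat, zero_add]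
    simp only [add_right_comm _ 1 d, add_assoc]
    ring

/-- The weighted shifted numbers. -/
noncomputable def V : Shuffle ℕ ℚ⟦X⟧ := twist timeWeight S

theorem symmetric_V : Symmetric V := symmetric_S.twist timeWeight

theorem eulerDer_V (d : ℕ) (l : List ℕ) :
    eulerDer (V l) = (X l : ℚ⟦X⟧) * V l - 4 * ∑ a ∈ Finset.range d, V (a :: l)
      - (l.map timeWeight).prod * (PowerSeries.C (4 ^ d) * w ^ (2 * d)
        * shiftSum fun c => S ((c + d) :: l)) := by
  have hsum : (l.map timeWeight).prod * ∑ a ∈ Finset.range d, timeShift a * S (a :: l)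
      = 4 * ∑ a ∈ Finset.range d, V (a :: l) := by
    rw [Finset.mul_sum, Finset.mul_sum]
    refine Finset.sum_congr rfl fun a _ => ?_
    rw [V, twist_apply, List.map_cons, List.prod_cons, timeShift_eq]
    ring
  have hV : V l = (l.map timeWeight).prod * S l := rfl
  rw [hV, eulerDer.leibniz, eulerDer_timeWeight_prod, eulerDer_S,
    shiftSum_eq_sum_add _ d]
  simp only [smul_eq_mul]
  linear_combination -hsum

theorem timeWeight_prod_mul_vir (d : ℕ) (l : List ℕ) :
    (l.map timeWeight).prod * (timeWeight d
        * vir (PowerSeries.C (1 / 2)) (PowerSeries.C (1 / 8)) d S l)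
      = w * vir 2 (PowerSeries.C (1 / 8)) d V l := by
  have hraise := DFunLike.congr_fun (raise_twist (timeWeight_add · d) S) l
  have hpair : (l.map timeWeight).prod
        * (timeWeight d * (PowerSeries.C (1 / 2) * pairDer d S l))
      = 2 * w * pairDer d V l := by
    rw [pairDer_apply, pairDer_apply]
    simp only [Finset.mul_sum]
    refine Finset.sum_congr rfl fun p hp => ?_
    rw [← mem_pairs.mp hp, V, twist_apply, List.map_cons, List.map_cons, List.prod_cons,
      List.prod_cons]
    have h2 : PowerSeries.C ((1 : ℚ) / 2) * PowerSeries.C 4 = 2 := by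
      rw [← map_mul, ← map_ofNat PowerSeries.C 2]
      norm_num
    simp only [timeWeight, map_pow]
    linear_combination (l.map timeWeight).prod * PowerSeries.C 4 ^ (p.1 + p.2)
      * w ^ (2 * (p.1 + p.2) + 3) * S (p.1 :: p.2 :: l) * h2
  have hzero : timeWeight d * (if d = 0 then PowerSeries.C (1 / 8) else 0)
      = w * if d = 0 then PowerSeries.C (1 / 8) else 0 := by
    split_ifs with hd
    · simp [hd, timeWeight]
    · simp
  rw [Shuffle.smul_apply, twist_apply] at hraise
  have hV : V l = (l.map timeWeight).prod * S l := rfl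
  rw [vir_apply, vir_apply, hV, V, hraise, ← V]
  linear_combination hpair + (l.map timeWeight).prod * S l * hzero
    + (l.map timeWeight).prod * raise d S l * timeWeight_eq d

theorem V_cons (d : ℕ) (l : List ℕ) :
    V (d :: l) = w * (vir 2 (PowerSeries.C (1 / 8)) d V l + eulerDer (V l)
      - (X l : ℚ⟦X⟧) * V l
      + 4 * ∑ a ∈ Finset.range d, V (a :: l)) := by
  have hV : V (d :: l) = (l.map timeWeight).prod * (timeWeight d * S (d :: l)) := by
    rw [V, twist_apply, List.map_cons, List.prod_cons]
    ring
  rw [hV]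
  linear_combination (l.map timeWeight).prod * timeWeight d * S_cons d l - w * eulerDer_V d l
    + timeWeight_prod_mul_vir d l
    - (l.map timeWeight).prod * (shiftSum fun c => S ((c + d) :: l)) * timeWeight_eq d

/-- The amplitudes, whose inverse factorial series expand the normalized disconnected numbers. -/
noncomputable def amp : Shuffle ℕ ℚ⟦X⟧ := subsum V

theorem der_amp (d : ℕ) : der d amp = amp + ones * der d V := rfl

theorem pairDer_amp (d : ℕ) :
    pairDer d amp = (d : ℚ⟦X⟧) • amp
      + ones * ((2 : ℚ⟦X⟧) • ∑ a ∈ Finset.range d, der a V + pairDer d V) := by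
  have hder : ∀ p : ℕ × ℕ, der p.2 (der p.1 amp)
      = amp + ones * (der p.1 V + der p.2 V + der p.2 (der p.1 V)) := fun p => by
    rw [der_amp, _root_.map_add, der_amp, der_mul]
    change amp + ones * der p.2 V
      + (ones * der p.1 V + ones * der p.2 (der p.1 V)) = _
    ring
  have hcard : (pairs d).card = d := by
    rw [Finset.card_eq_sum_ones, sum_pairs d fun _ => 1]
    simp
  have hfst : ∑ p ∈ pairs d, der p.1 V = ∑ a ∈ Finset.range d, der a V := sum_pairs d _
  have hsnd : ∑ p ∈ pairs d, der p.2 V = ∑ p ∈ pairs d, der p.1 V :=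
    sum_pairs_swap d fun p => der p.1 V
  rw [pairDer_eq_sum, pairDer_eq_sum, Finset.sum_congr rfl fun p _ => hder p,
    Finset.sum_add_distrib, ← Finset.mul_sum, Finset.sum_add_distrib, Finset.sum_add_distrib, hsnd,
    hfst, Finset.sum_const, hcard, two_smul, Nat.cast_smul_eq_nsmul]

theorem amp_cons (d : ℕ) (l : List ℕ) :
    amp (d :: l) = amp l + w * (vir 2 (PowerSeries.C (1 / 8)) d amp l + eulerDer (amp l)
      - ((X l : ℚ⟦X⟧) + 2 * d) * amp l) := by
  have hV : der d V = w • (vir 2 (PowerSeries.C (1 / 8)) d V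
      + Shuffle.map (eulerDer : ℚ⟦X⟧ →+ ℚ⟦X⟧) V - raise 0 V
      + (4 : ℚ⟦X⟧) • ∑ a ∈ Finset.range d, der a V) := by
    ext1 l
    simpa [raise_zero_apply, mul_add] using V_cons d l
  have hraise : ∀ e, raise e amp = raise 0 ones * V + ones * raise e V :=
    fun e => by
      rw [amp, subsum, raise_mul]
      congr 2
      ext l
      simp [raise_apply]
  have heuler : Shuffle.map (eulerDer : ℚ⟦X⟧ →+ ℚ⟦X⟧) amp
      = ones * Shuffle.map (eulerDer : ℚ⟦X⟧ →+ ℚ⟦X⟧) V := by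
    rw [amp, subsum, map_derivation_mul, add_eq_right]
    convert zero_mul V
    ext1 l
    simp
  have hamp : der d amp = amp + w • (vir 2 (PowerSeries.C (1 / 8)) d amp
      + Shuffle.map (eulerDer : ℚ⟦X⟧ →+ ℚ⟦X⟧) amp - raise 0 amp - (2 * d : ℚ⟦X⟧) • amp) := by
    rw [der_amp, hV, heuler, vir_eq, vir_eq, hraise d, hraise 0, pairDer_amp, amp, subsum]
    simp only [Algebra.smul_def, map_mul, map_ofNat, map_natCast]
    ring
  have := DFunLike.congr_fun hamp l
  simp only [der_apply, Shuffle.add_apply, Shuffle.sub_apply, Shuffle.smul_apply, map_apply,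
    raise_zero_apply] at this
  rw [this, AddMonoidHom.coe_coe]
  ring

/-- The connected amplitudes: `S` divided by its value at `w = 0`, with the weights restored. -/
noncomputable def connSeries : Shuffle ℕ ℚ⟦X⟧ :=
  V * twist timeWeight (Shuffle.map (PowerSeries.C : ℚ →+* ℚ⟦X⟧).toAddMonoidHom Zinv)

theorem X_pow_dvd_connSeries {l : List ℕ} (hl : l ≠ []) : w ^ (X l + 1) ∣ connSeries l := by
  have h0 : Shuffle.map (constantCoeff : ℚ⟦X⟧ →+* ℚ).toAddMonoidHom
      (S * Shuffle.map (PowerSeries.C : ℚ →+* ℚ⟦X⟧).toAddMonoidHom Zinv) = 1 := by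
    rw [map_ringHom_mul, map_constantCoeff_S, ← Z_mul_Zinv]
    congr 1
  rw [connSeries, V, ← twist_mul, twist_apply, pow_succ]
  refine mul_dvd_mul (X_pow_dvd_timeWeight_prod l) (X_dvd_iff.mpr ?_)
  obtain ⟨a, l, rfl⟩ := List.exists_cons_of_ne_nil hl
  exact DFunLike.congr_fun h0 (a :: l)

theorem connSeries_nil : connSeries [] = S [] := by
  simp [connSeries, V, Zinv]

theorem amp_nil : amp [] = S [] := by
  simp [amp, V]

theorem symmetric_connSeries : Symmetric connSeries :=
  symmetric_V.mul ((symmetric_Zinv.map _).twist _)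

end Amplitudes

/-! ### Inverse factorial expansions -/

section InverseFactorials

/-- The inverse factorial `1 / ((x - 1) ⋯ (x - k))`; the expansion parameter `w` stands for it in
the sense that `w ^ k` is replaced by `invFact k x`. -/
noncomputable def invFact (k : ℕ) (x : ℝ) : ℝ := ∏ i ∈ Finset.range k, (x - (i + 1))⁻¹

@[simp] theorem invFact_zero (x : ℝ) : invFact 0 x = 1 := Finset.prod_range_zero _

theorem invFact_succ (k : ℕ) (x : ℝ) : invFact (k + 1) x = invFact k x * (x - (k + 1))⁻¹ :=
  Finset.prod_range_succ _ _

theorem invFact_add (j k : ℕ) (x : ℝ) : invFact (j + k) x = invFact j x * invFact k (x - j) := by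
  rw [invFact, Finset.prod_range_add, invFact, invFact]
  push_cast
  simp only [sub_sub, add_assoc]

theorem invFact_sub_one (k : ℕ) {x : ℝ} (hx : (k : ℝ) + 1 < x) :
    invFact k (x - 1) = invFact k x + k * invFact (k + 1) x := by
  have : (0 : ℝ) ≤ k := Nat.cast_nonneg k
  have hfirst : invFact (k + 1) x = (x - 1)⁻¹ * invFact k (x - 1) := by
    rw [add_comm k 1, invFact_add]
    simp [invFact]
  have hlast := invFact_succ k x
  rw [← div_eq_mul_inv, eq_div_iff (by linarith)] at hlast
  rw [← div_eq_inv_mul, eq_div_iff (by linarith)] at hfirst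
  linear_combination hlast - hfirst

end InverseFactorials

section Decay

theorem inv_affine_isTheta {a : ℝ} (ha : a ≠ 0) (b : ℝ) :
    (fun m : ℕ => (a * m + b)⁻¹) =Θ[atTop] fun m : ℕ => (m : ℝ)⁻¹ := by
  have hb : (fun _ : ℕ => b) =o[atTop] fun m : ℕ => a * (m : ℝ) :=
    ((isLittleO_const_id_atTop b).comp_tendsto tendsto_natCast_atTop_atTop).const_mul_right ha
  exact ((IsEquivalent.refl.add_isLittleO hb).isTheta.trans
    (isTheta_rfl.const_mul_left ha)).inv

theorem inv_pow_isBigO {j k : ℕ} (h : j ≤ k) :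
    (fun m : ℕ => (m : ℝ)⁻¹ ^ k) =O[atTop] fun m : ℕ => (m : ℝ)⁻¹ ^ j := by
  have hone := ((tendsto_inv_atTop_nhds_zero_nat (𝕜 := ℝ)).pow (k - j)).isBigO_one ℝ
  refine ((isBigO_refl (fun m : ℕ => (m : ℝ)⁻¹ ^ j) atTop).mul hone).congr (fun m => ?_)
    fun m => mul_one _
  rw [← pow_add, Nat.add_sub_of_le h]

theorem invFact_affine_isBigO {a : ℝ} (ha : a ≠ 0) (b : ℝ) (k : ℕ) :
    (fun m : ℕ => invFact k (a * m + b)) =O[atTop] fun m : ℕ => (m : ℝ)⁻¹ ^ k := by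
  induction k with
  | zero => simpa using isBigO_refl (fun _ : ℕ => (1 : ℝ)) atTop
  | succ k ih =>
    simp only [invFact_succ, pow_succ, add_sub_assoc]
    exact ih.mul (inv_affine_isTheta ha _).isBigO

end Decay

/-- The partial sum `∑_{k < L} g_k / ((x - 1) ⋯ (x - k))` of an inverse factorial series. -/
noncomputable def invFactSum (g : ℚ⟦X⟧) (L : ℕ) (x : ℝ) : ℝ :=
  ∑ k ∈ Finset.range L, ((coeff k g : ℚ) : ℝ) * invFact k x

section PartialSums

theorem invFactSum_succ (g : ℚ⟦X⟧) (L : ℕ) (x : ℝ) :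
    invFactSum g (L + 1) x = invFactSum g L x + ((coeff L g : ℚ) : ℝ) * invFact L x :=
  Finset.sum_range_succ _ _

theorem invFactSum_X_pow_mul (g : ℚ⟦X⟧) (j L : ℕ) (x : ℝ) :
    invFactSum (w ^ j * g) (L + j) x = invFact j x * invFactSum g L (x - j) := by
  have hlow : ∑ k ∈ Finset.range j, ((coeff k (w ^ j * g) : ℚ) : ℝ) * invFact k x = 0 :=
    Finset.sum_eq_zero fun k hk => by
      rw [coeff_X_pow_mul', if_neg (Finset.mem_range.mp hk).not_ge, Rat.cast_zero, zero_mul]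
  rw [invFactSum, invFactSum, add_comm L j, Finset.sum_range_add, hlow, zero_add, Finset.mul_sum]
  refine Finset.sum_congr rfl fun k _ => ?_
  rw [coeff_X_pow_mul', if_pos (Nat.le_add_right j k), Nat.add_sub_cancel_left, invFact_add]
  ring

theorem invFactSum_add_X_mul_eulerDer (g : ℚ⟦X⟧) (L : ℕ) {x : ℝ} (hx : (L : ℝ) < x) :
    invFactSum (g + w * eulerDer g) (L + 1) x
      = invFactSum g L (x - 1) + ((coeff L g : ℚ) : ℝ) * invFact L x := by
  induction L with
  | zero => simp [invFactSum]
  | succ L ih =>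
    push_cast at hx
    rw [invFactSum_succ, ih (by linarith), invFactSum_succ g L, invFact_sub_one L hx, map_add,
      coeff_succ_X_mul, coeff_eulerDer]
    push_cast
    ring

end PartialSums

/-- `h m` has the asymptotic expansion `∑ g_k / ((x - 1) ⋯ (x - k))`, `x = 2 m + x₀`, as
`m → ∞`. -/
def HasInvFactExp (x₀ : ℕ) (h : ℕ → ℝ) (g : ℚ⟦X⟧) : Prop :=
  ∀ L : ℕ, (fun m : ℕ => h m - invFactSum g L (2 * m + x₀)) =O[atTop] fun m : ℕ => (m : ℝ)⁻¹ ^ L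

namespace HasInvFactExp

variable {x₀ : ℕ} {h h' : ℕ → ℝ} {g g' : ℚ⟦X⟧}

theorem of_add_order (j : ℕ)
    (H : ∀ L : ℕ, (fun m : ℕ => h m - invFactSum g (L + j) (2 * m + x₀)) =O[atTop]
      fun m : ℕ => (m : ℝ)⁻¹ ^ L) : HasInvFactExp x₀ h g := by
  intro L
  have hextra : (fun m : ℕ => ∑ i ∈ Finset.range j,
      ((coeff (L + i) g : ℚ) : ℝ) * invFact (L + i) (2 * m + x₀)) =O[atTop]
        fun m : ℕ => (m : ℝ)⁻¹ ^ L :=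
    IsBigO.fun_sum fun i _ => .const_mul_left ((invFact_affine_isBigO two_ne_zero _ _).trans
      (inv_pow_isBigO (Nat.le_add_right L i))) _
  refine ((H L).add hextra).congr_left fun m => ?_
  rw [invFactSum, invFactSum, Finset.sum_range_add]
  ring

theorem add (H : HasInvFactExp x₀ h g) (H' : HasInvFactExp x₀ h' g') :
    HasInvFactExp x₀ (fun m => h m + h' m) (g + g') := fun L =>
  ((H L).add (H' L)).congr_left fun m => by
    simp only [invFactSum, map_add, Rat.cast_add, add_mul, Finset.sum_add_distrib]
    ring

theorem const_mul (c : ℚ) (H : HasInvFactExp x₀ h g) :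
    HasInvFactExp x₀ (fun m => c * h m) (PowerSeries.C c * g) := fun L =>
  ((H L).const_mul_left (c : ℝ)).congr_left fun m => by
    simp only [invFactSum, coeff_C_mul, Rat.cast_mul, mul_sub, Finset.mul_sum, mul_assoc]

theorem sum {ι : Type*} (s : Finset ι) {h : ι → ℕ → ℝ} {g : ι → ℚ⟦X⟧}
    (H : ∀ i ∈ s, HasInvFactExp x₀ (h i) (g i)) :
    HasInvFactExp x₀ (fun m => ∑ i ∈ s, h i m) (∑ i ∈ s, g i) := fun L =>
  (IsBigO.fun_sum fun i hi => H i hi L).congr_left fun m => by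
    simp only [invFactSum, map_sum, Rat.cast_sum, Finset.sum_mul, Finset.sum_sub_distrib]
    rw [Finset.sum_comm]

theorem congr' (H : HasInvFactExp x₀ h g) (e : h =ᶠ[atTop] h') : HasInvFactExp x₀ h' g :=
  fun L => (H L).congr' (e.sub .rfl) .rfl

theorem shift_arg (H : HasInvFactExp x₀ h g) (d : ℕ) :
    HasInvFactExp (x₀ + 2 * d) (fun m => h (m + d)) g := by
  intro L
  have hshift := (inv_affine_isTheta one_ne_zero (d : ℝ)).isBigO.pow L
  refine (((H L).comp_tendsto (tendsto_add_atTop_nat d)).trans ?_).congr_left fun m => ?_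
  · simpa only [Function.comp_def, Nat.cast_add, one_mul] using hshift
  · simp only [Function.comp_apply, Nat.cast_add, Nat.cast_mul, Nat.cast_ofNat]
    ring_nf

theorem invFact_mul (H : HasInvFactExp x₀ h g) (j : ℕ) :
    HasInvFactExp (x₀ + j) (fun m => invFact j (2 * m + (x₀ + j : ℕ)) * h m) (w ^ j * g) := by
  refine of_add_order j fun L => ?_
  have hmul := (invFact_affine_isBigO two_ne_zero ((x₀ + j : ℕ) : ℝ) j).mul (H L)
  simp only [← pow_add] at hmul
  refine (hmul.trans (inv_pow_isBigO (Nat.le_add_left L j))).congr_left fun m => ?_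
  rw [invFactSum_X_pow_mul, mul_sub, Nat.cast_add, ← add_assoc, add_sub_cancel_right]

theorem shift_base (H : HasInvFactExp x₀ h g) :
    HasInvFactExp (x₀ + 1) h (g + w * eulerDer g) := by
  refine of_add_order 1 fun L => ?_
  have htop := (invFact_affine_isBigO two_ne_zero ((x₀ + 1 : ℕ) : ℝ) L).const_mul_left
    ((coeff L g : ℚ) : ℝ)
  refine ((H L).sub htop).congr' ?_ .rfl
  filter_upwards [eventually_ge_atTop L] with m hm
  have hL : (L : ℝ) < 2 * m + (x₀ + 1 : ℕ) := by
    exact_mod_cast (by omega : L < 2 * m + (x₀ + 1))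
  rw [invFactSum_add_X_mul_eulerDer g L hL, sub_sub, Nat.cast_succ, ← add_assoc,
    add_sub_cancel_right]

theorem vir (u v : ℚ) {d : ℕ} {f : ℕ → Shuffle ℕ ℝ} {g : Shuffle ℕ ℚ⟦X⟧} {l : List ℕ}
    (H : ∀ l', X l' = X l + 2 * d → HasInvFactExp x₀ (fun m => f m l') (g l')) :
    HasInvFactExp x₀ (fun m => Shuffle.vir (u : ℝ) (v : ℝ) d (f m) l)
      (Shuffle.vir (PowerSeries.C u) (PowerSeries.C v) d g l) := by
  simp only [Shuffle.vir_apply, Shuffle.raise_apply, Shuffle.pairDer_apply]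
  have hraise := HasInvFactExp.sum Finset.univ fun (i : Fin l.length) _ =>
    (H _ (X_set l i d)).const_mul (2 * l.get i + 1)
  have hpair := HasInvFactExp.sum (pairs d) fun p hp =>
    H (p.1 :: p.2 :: l) (by
      have := mem_pairs.mp hp
      simp only [X_cons]
      omega)
  have hdelta : HasInvFactExp x₀ (fun m => (if d = 0 then (v : ℝ) else 0) * f m l)
      ((if d = 0 then PowerSeries.C v else 0) * g l) := by
    rcases eq_or_ne d 0 with rfl | hd
    · simpa using (H l rfl).const_mul v
    · intro L
      simpa [hd, invFactSum] using isBigO_zero _ _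
  simpa [map_ofNat] using (hraise.add (hpair.const_mul u)).add hdelta

end HasInvFactExp

section Gamma

theorem gam_pos {x : ℝ} (hx : -1 < x) : 0 < gam x := by
  have hnum := Real.Gamma_pos_of_pos (show 0 < x / 2 + 1 by linarith)
  have hden := Real.Gamma_pos_of_pos (show 0 < (x + 1) / 2 by linarith)
  have hden' := Real.Gamma_pos_of_pos (show 0 < (x + 3) / 2 by linarith)
  have := Real.pi_pos
  unfold gam
  positivity

theorem gam_eq {x : ℝ} (hx : x ≠ -1) :
    gam x = 2 / (x + 1) * Real.Gamma (x / 2 + 1) ^ 2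
      / (Real.pi * Real.Gamma ((x + 1) / 2) ^ 2) := by
  have hx' : x + 1 ≠ 0 := fun h => hx (by linarith)
  rw [gam, show (x + 3) / 2 = (x + 1) / 2 + 1 by ring,
    Real.Gamma_add_one (div_ne_zero hx' two_ne_zero)]
  field_simp

theorem pi_gam_mul_pi_gam_sub_one {x : ℝ} (hx : 0 < x) :
    (Real.pi * gam x) * (Real.pi * gam (x - 1)) = x / (x + 1) := by
  have hodd := (Real.Gamma_pos_of_pos (show 0 < (x + 1) / 2 by linarith)).ne'
  have heven := (Real.Gamma_pos_of_pos (show 0 < x / 2 by linarith)).ne'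
  rw [gam_eq (x := x) (by linarith), gam_eq (x := x - 1) (by linarith),
    show (x - 1) / 2 + 1 = (x + 1) / 2 by ring,
    show x - 1 + 1 = x by ring, Real.Gamma_add_one (by linarith)]
  field_simp

theorem gam_recurrence {x : ℝ} (hx : 1 < x) : (x ^ 2 - 1) * gam x = x ^ 2 * gam (x - 2) := by
  have hx₁ := pi_gam_mul_pi_gam_sub_one (show 0 < x by linarith)
  have hx₂ := pi_gam_mul_pi_gam_sub_one (show 0 < x - 1 by linarith)
  have hpos : Real.pi * (Real.pi * gam (x - 1)) ≠ 0 :=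
    (mul_pos Real.pi_pos (mul_pos Real.pi_pos (gam_pos (by linarith)))).ne'
  rw [eq_div_iff (by linarith)] at hx₁ hx₂
  rw [show x - 1 - 1 = x - 2 by ring, sub_add_cancel] at hx₂
  refine mul_left_cancel₀ hpos ?_
  linear_combination (x - 1) * hx₁ - x * hx₂

theorem pi_gam_le_one {x : ℝ} (hx : -1 < x) : Real.pi * gam x ≤ 1 := by
  have hlow := Real.Gamma_pos_of_pos (show 0 < (x + 1) / 2 by linarith)
  have hhigh := Real.Gamma_pos_of_pos (show 0 < (x + 3) / 2 by linarith)
  have hmid := Real.Gamma_pos_of_pos (show 0 < x / 2 + 1 by linarith)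
  have hconvex := Real.Gamma_mul_add_mul_le_rpow_Gamma_mul_rpow_Gamma
    (show 0 < (x + 1) / 2 by linarith) (show 0 < (x + 3) / 2 by linarith)
    (show (0 : ℝ) < 1 / 2 by norm_num) (show (0 : ℝ) < 1 / 2 by norm_num) (by norm_num)
  rw [show 1 / 2 * ((x + 1) / 2) + 1 / 2 * ((x + 3) / 2) = x / 2 + 1 by ring,
    ← Real.mul_rpow hlow.le hhigh.le, ← Real.sqrt_eq_rpow,
    Real.le_sqrt hmid.le (mul_pos hlow hhigh).le] at hconvex
  rw [gam, mul_assoc, ← div_div, div_right_comm, mul_div_cancel₀ _ Real.pi_ne_zero]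
  exact div_le_one_of_le₀ hconvex (mul_pos hlow hhigh).le

theorem le_pi_gam {x : ℝ} (hx : 0 < x) : x / (x + 1) ≤ Real.pi * gam x := by
  rw [← pi_gam_mul_pi_gam_sub_one hx]
  exact mul_le_of_le_one_right (mul_pos Real.pi_pos (gam_pos (by linarith))).le
    (pi_gam_le_one (by linarith))

theorem tendsto_pi_gam : Tendsto (fun x : ℕ => Real.pi * gam x) atTop (nhds 1) := by
  refine tendsto_of_tendsto_of_tendsto_of_le_of_le' (tendsto_natCast_div_add_atTop (1 : ℝ))
    tendsto_const_nhds ?_ (Eventually.of_forall fun x => pi_gam_le_one ?_)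
  · filter_upwards [eventually_gt_atTop 0] with x hx using le_pi_gam (Nat.cast_pos.mpr hx)
  · linarith [x.cast_nonneg (α := ℝ)]

end Gamma

section TwoStepDifferences

theorem abs_le_of_abs_sub_le {f b : ℕ → ℝ} {p N : ℕ} (hp : 0 < p)
    (hf : Tendsto f atTop (nhds 0)) (hb : ∀ x, 0 ≤ b x)
    (h : ∀ x, N ≤ x → |f (x + p) - f x| ≤ b x - b (x + p)) {x : ℕ} (hx : N ≤ x) :
    |f x| ≤ b x := by
  have htelescope : ∀ j : ℕ, |f x| ≤ |f (x + p * j)| + b x - b (x + p * j) := by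
    intro j
    induction j with
    | zero => simp
    | succ j ih =>
      have hstep := h (x + p * j) (by omega)
      have htri := abs_sub_abs_le_abs_sub (f (x + p * j)) (f (x + p * j + p))
      rw [abs_sub_comm] at htri
      rw [mul_add_one, ← add_assoc]
      linarith
  have hlim : Tendsto (fun j : ℕ => |f (x + p * j)| + b x) atTop (nhds (0 + b x)) := by
    have hj : Tendsto (fun j : ℕ => x + p * j) atTop atTop :=
      tendsto_atTop_mono (fun j => (Nat.le_mul_of_pos_left j hp).trans (Nat.le_add_left _ _))
        tendsto_id
    simpa only [abs_zero, Function.comp_apply] using (hf.comp hj).abs.add_const (b x)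
  rw [zero_add] at hlim
  exact ge_of_tendsto' hlim fun j => by linarith [htelescope j, hb (x + p * j)]

theorem inv_pow_succ_le {x : ℝ} (hx : 1 ≤ x) {L : ℕ} (hL : L ≠ 0) :
    x⁻¹ ^ (L + 1) ≤ 2 * x⁻¹ ^ L - 2 * (x + 2)⁻¹ ^ L := by
  have hx₀ : 0 < x := by linarith
  have hratio : (x / (x + 2)) ^ L ≤ x / (x + 2) :=
    pow_le_of_le_one (by positivity) (div_le_one_of_le₀ (by linarith) (by linarith)) hL
  have hfactor : (x + 2)⁻¹ ^ L = x⁻¹ ^ L * (x / (x + 2)) ^ L := by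
    rw [← mul_pow]
    congr 1
    field_simp
  have hone : x⁻¹ ≤ 2 * (1 - x / (x + 2)) := by
    rw [show 2 * (1 - x / (x + 2)) = 4 / (x + 2) by field_simp; ring, inv_eq_one_div,
      div_le_div_iff₀ hx₀ (by linarith)]
    linarith
  have hscale := mul_le_mul_of_nonneg_left
    (hone.trans (by linarith : _ ≤ 2 * (1 - (x / (x + 2)) ^ L))) (by positivity : 0 ≤ x⁻¹ ^ L)
  rw [pow_succ, hfactor]
  linarith

theorem isBigO_of_two_step_diff {f : ℕ → ℝ} (hf : Tendsto f atTop (nhds 0)) {L : ℕ} (hL : L ≠ 0)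
    (h : (fun x : ℕ => f (x + 2) - f x) =O[atTop] fun x : ℕ => (x : ℝ)⁻¹ ^ (L + 1)) :
    f =O[atTop] fun x : ℕ => (x : ℝ)⁻¹ ^ L := by
  obtain ⟨c, hc, hbound⟩ := h.exists_pos
  obtain ⟨N, hN⟩ := eventually_atTop.mp hbound.bound
  have hstep : ∀ x, N + 1 ≤ x → |f (x + 2) - f x|
      ≤ 2 * c * (x : ℝ)⁻¹ ^ L - 2 * c * ((x + 2 : ℕ) : ℝ)⁻¹ ^ L := by
    intro x hx
    have hfx := hN x (by omega)
    have hx₁ : (1 : ℝ) ≤ x := by exact_mod_cast (by omega : 1 ≤ x)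
    rw [Real.norm_eq_abs, Real.norm_of_nonneg (by positivity)] at hfx
    have hscale := mul_le_mul_of_nonneg_left (inv_pow_succ_le hx₁ hL) hc.le
    push_cast
    linarith
  refine IsBigO.of_bound (2 * c) ?_
  filter_upwards [eventually_ge_atTop (N + 1)] with x hx
  rw [Real.norm_eq_abs, Real.norm_of_nonneg (by positivity)]
  exact abs_le_of_abs_sub_le two_pos hf (fun x => by positivity) hstep hx

end TwoStepDifferences

section ExpansionOfGamma

theorem invFact_three_term (k : ℕ) {x : ℝ} (hx : (k : ℝ) + 2 < x) :
    (x + 1) * invFact k x - x ^ 2 / (x - 1) * invFact k (x - 2)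
      = -(2 * k * invFact k x + (3 * (k : ℝ) ^ 2 + 5 * k + 1) * invFact (k + 1) x
        + k * (k + 2) ^ 2 * invFact (k + 2) x) := by
  have : (0 : ℝ) ≤ k := Nat.cast_nonneg k
  have hx₁ : x - 1 ≠ 0 := by linarith
  have hshift : invFact k (x - 2)
      = invFact k x + 2 * k * invFact (k + 1) x + k * (k + 1) * invFact (k + 2) x := by
    rw [show x - 2 = x - 1 - 1 by ring, invFact_sub_one k (by linarith),
      invFact_sub_one k (by linarith), invFact_sub_one (k + 1) (by push_cast; linarith)]
    push_cast
    ring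
  have hsucc : invFact k x = (x - (k + 1)) * invFact (k + 1) x := by
    rw [invFact_succ, mul_comm, inv_mul_cancel_right₀ (by linarith)]
  have hsucc' : invFact (k + 1) x = (x - (k + 2)) * invFact (k + 2) x := by
    rw [invFact_succ (k + 1), mul_comm]
    push_cast
    rw [add_assoc, one_add_one_eq_two, inv_mul_cancel_right₀ (by linarith)]
  rw [hshift, hsucc, hsucc']
  field_simp
  ring

/-- The defect of the partial sums of the inverse factorial series `S []` in the difference
equation `(x + 1) f(x) = x² / (x - 1) f(x - 2)` solved by `γ`. -/
noncomputable def nilDefect (n : ℕ) (x : ℝ) : ℝ :=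
  2 * (n + 1) * (coeff (n + 1) (S []) : ℚ) * invFact (n + 1) x
    - n * (n + 2) ^ 2 * (coeff n (S []) : ℚ) * invFact (n + 2) x

theorem sub_eq_nilDefect (n : ℕ) {x : ℝ} (hx : (n : ℝ) + 3 < x) :
    (x + 1) * invFactSum (S []) (n + 1) x
      - x ^ 2 / (x - 1) * invFactSum (S []) (n + 1) (x - 2) = nilDefect n x := by
  induction n with
  | zero =>
    have h := invFact_three_term 0 (x := x) (by push_cast at hx ⊢; linarith)
    rw [invFactSum, invFactSum, Finset.sum_range_one, Finset.sum_range_one, nilDefect,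
      coeff_one_S_nil, coeff_zero_S_nil]
    push_cast at h ⊢
    linear_combination h
  | succ n ih =>
    push_cast at hx
    have hprev := ih (by linarith)
    have hterm := invFact_three_term (n + 1) (x := x) (by push_cast; linarith)
    have hcoeff := congrArg (Rat.cast : ℚ → ℝ) (S_nil_recurrence n)
    rw [invFactSum_succ _ (n + 1) x, invFactSum_succ _ (n + 1) (x - 2)]
    rw [nilDefect] at hprev ⊢
    push_cast at hterm hcoeff ⊢
    rw [show n + 1 + 1 = n + 2 by ring] at hterm ⊢
    linear_combination hprev + ((coeff (n + 1) (S []) : ℚ) : ℝ) * hterm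
      - invFact (n + 2) x * hcoeff

theorem nilDefect_isBigO (n : ℕ) :
    (fun x : ℕ => nilDefect n x) =O[atTop] fun x : ℕ => (x : ℝ)⁻¹ ^ (n + 1) := by
  have hO (k : ℕ) : (fun x : ℕ => invFact k x) =O[atTop] fun x : ℕ => (x : ℝ)⁻¹ ^ k := by
    simpa only [one_mul, add_zero] using invFact_affine_isBigO one_ne_zero 0 k
  exact ((hO (n + 1)).const_mul_left _).sub
    (((hO (n + 2)).trans (inv_pow_isBigO (Nat.le_succ _))).const_mul_left _)

theorem invFactSum_div_pi_gam_sub (n : ℕ) {x : ℝ} (hx : (n : ℝ) + 3 < x) :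
    invFactSum (S []) (n + 1) x / (Real.pi * gam x)
      - invFactSum (S []) (n + 1) (x - 2) / (Real.pi * gam (x - 2))
      = nilDefect n x * ((x + 1)⁻¹ * (Real.pi * gam x)⁻¹) := by
  have : (0 : ℝ) ≤ n := Nat.cast_nonneg n
  have hgam := gam_recurrence (x := x) (by linarith)
  have hpos := (gam_pos (x := x) (by linarith)).ne'
  have hpos' := (gam_pos (x := x - 2) (by linarith)).ne'
  have hx₁ : x - 1 ≠ 0 := by linarith
  have hx₂ : x + 1 ≠ 0 := by linarith
  have hpi := Real.pi_ne_zero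
  rw [← sub_eq_nilDefect n hx]
  field_simp
  linear_combination -(invFactSum (S []) (n + 1) (x - 2)) * hgam

theorem tendsto_invFactSum (n : ℕ) {g : ℚ⟦X⟧} :
    Tendsto (fun x : ℕ => invFactSum g (n + 1) x) atTop (nhds (coeff 0 g : ℚ)) := by
  have hterm (k : ℕ) : Tendsto (fun x : ℕ => ((coeff (k + 1) g : ℚ) : ℝ) * invFact (k + 1) x)
      atTop (nhds 0) := by
    have hO := invFact_affine_isBigO one_ne_zero 0 (k + 1)
    have hlim := (tendsto_inv_atTop_nhds_zero_nat (𝕜 := ℝ)).pow (k + 1)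
    rw [zero_pow k.succ_ne_zero] at hlim
    simpa using (hO.trans_tendsto hlim).const_mul ((coeff (k + 1) g : ℚ) : ℝ)
  have hsum := (tendsto_finsetSum (Finset.range n) fun k _ => hterm k).add_const
    ((coeff 0 g : ℚ) : ℝ)
  rw [Finset.sum_const_zero, zero_add] at hsum
  refine hsum.congr fun x => ?_
  rw [invFactSum, Finset.sum_range_succ', invFact_zero, mul_one]

theorem one_sub_invFactSum_div_isBigO (n : ℕ) :
    (fun x : ℕ => 1 - invFactSum (S []) (n + 1) x / (Real.pi * gam x)) =O[atTop]
      fun x : ℕ => (x : ℝ)⁻¹ ^ (n + 1) := by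
  refine isBigO_of_two_step_diff ?_ n.succ_ne_zero ?_
  · have hlim := (tendsto_invFactSum n (g := S [])).div tendsto_pi_gam one_ne_zero
    simpa [-coeff_S, -coeff_zero_eq_constantCoeff, coeff_zero_S_nil] using hlim.const_sub 1
  have hinv : (fun x : ℕ => ((x : ℝ) + 1)⁻¹) =O[atTop] fun x : ℕ => (x : ℝ)⁻¹ := by
    simpa only [one_mul] using (inv_affine_isTheta one_ne_zero 1).isBigO
  have hpi := (tendsto_pi_gam.inv₀ one_ne_zero).isBigO_one ℝ
  have hdefect : (fun x : ℕ => nilDefect n x * (((x : ℝ) + 1)⁻¹ * (Real.pi * gam x)⁻¹)) =O[atTop]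
      fun x : ℕ => (x : ℝ)⁻¹ ^ (n + 2) := by
    simpa only [mul_one, ← pow_succ] using (nilDefect_isBigO n).mul (hinv.mul hpi)
  have hshift : (fun x : ℕ => ((x + 2 : ℕ) : ℝ)⁻¹ ^ (n + 2)) =O[atTop]
      fun x : ℕ => (x : ℝ)⁻¹ ^ (n + 2) := by
    simpa only [one_mul, Nat.cast_add, Nat.cast_ofNat] using
      (inv_affine_isTheta one_ne_zero 2).isBigO.pow (n + 2)
  refine ((hdefect.comp_tendsto (tendsto_add_atTop_nat 2)).trans hshift).neg_left.congr' ?_ .rfl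
  filter_upwards [eventually_gt_atTop (n + 1)] with x hx
  have hx' : (n : ℝ) + 3 < (x : ℝ) + 2 := by exact_mod_cast (by omega : n + 3 < x + 2)
  have hdiff := invFactSum_div_pi_gam_sub n hx'
  rw [add_sub_cancel_right] at hdiff
  simp only [Function.comp_apply, Nat.cast_add, Nat.cast_ofNat]
  rw [← hdiff]
  ring

theorem pi_gam_sub_invFactSum_isBigO (L : ℕ) :
    (fun x : ℕ => Real.pi * gam x - invFactSum (S []) L x) =O[atTop]
      fun x : ℕ => (x : ℝ)⁻¹ ^ L := by
  cases L with
  | zero => simpa [invFactSum] using tendsto_pi_gam.isBigO_one ℝ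
  | succ n =>
    have hmul := (tendsto_pi_gam.isBigO_one ℝ).mul (one_sub_invFactSum_div_isBigO n)
    simp only [one_mul] at hmul
    refine hmul.congr_left fun x => ?_
    have hgam := gam_pos (x := x) (by linarith [x.cast_nonneg (α := ℝ)])
    rw [mul_sub, mul_one, mul_div_cancel₀ _ (mul_pos Real.pi_pos hgam).ne']

theorem hasInvFactExp_gam (x₀ : ℕ) :
    HasInvFactExp x₀ (fun m => Real.pi * gam (2 * m + x₀)) (S []) := by
  intro L
  have hcomp := (pi_gam_sub_invFactSum_isBigO L).comp_tendsto
    (tendsto_atTop_mono (fun m : ℕ => by omega : ∀ m, m ≤ 2 * m + x₀) tendsto_id)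
  refine (hcomp.trans ?_).congr_left fun m => ?_
  · simpa [Function.comp_def] using (inv_affine_isTheta two_ne_zero (x₀ : ℝ)).isBigO.pow L
  · simp only [Function.comp_apply]
    push_cast
    rfl

end ExpansionOfGamma

/-! ### Expansion of the normalized numbers -/

section Normalization

theorem X_eq_two_mul_sum_add_length (l : List ℕ) : X l = 2 * l.sum + l.length := by
  induction l with
  | nil => rfl
  | cons d l ih =>
    rw [X_cons, ih, List.sum_cons, List.length_cons]
    ring

theorem X_append_singleton (l : List ℕ) (m : ℕ) : X (l ++ [m]) = X l + 2 * m + 1 := by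
  simp [X, add_assoc]

/-- `π` times the factor relating `C` to `B` at a word `l ++ [m]` with `l.sum = s` and `X l = x`;
the factor `π` is part of `π γ`, which tends to `1`. -/
noncomputable def normFactor (s x m : ℕ) : ℝ := Real.pi * (2 * 4 ^ (s + m) / (x + 2 * m)!)

theorem normFactor_add (s x m d : ℕ) :
    normFactor s x (m + d) = normFactor (s + d) (x + 2 * d) m := by
  rw [normFactor, normFactor, add_assoc s, add_comm d, add_assoc x, ← mul_add, add_comm d]

theorem normFactor_add_left (s d x m : ℕ) :
    normFactor (s + d) x m = 4 ^ d * normFactor s x m := by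
  rw [normFactor, normFactor, add_right_comm, pow_add]
  ring

theorem mul_normFactor_succ (s x m : ℕ) :
    (x + 1 + 2 * m) * normFactor s (x + 1) m = normFactor s x m := by
  have hfact : ((x + 2 * m)! : ℝ) ≠ 0 := by positivity
  have hsucc : (x : ℝ) + 2 * m + 1 ≠ 0 := by positivity
  rw [normFactor, normFactor, add_right_comm x, Nat.factorial_succ]
  push_cast
  field_simp
  ring

theorem C_append_singleton (l : List ℕ) (m : ℕ) :
    Real.pi * (C (l ++ [m]) : ℝ) = normFactor l.sum (X l) m * (B (l ++ [m]) : ℝ) := by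
  have hfactorials : ((((l ++ [m]).map fun d => (2 * d + 1)‼).prod : ℕ) : ℚ) ≠ 0 := by
    refine Nat.cast_ne_zero.mpr (List.prod_ne_zero fun h => ?_)
    obtain ⟨d, -, hd⟩ := List.mem_map.mp h
    exact (Nat.doubleFactorial_pos _).ne' hd
  have hexp : 2 * genus (l ++ [m]) - 1 = 2 * (l.sum + m) + 1 := by
    rw [genus, List.sum_append, List.sum_singleton]
    omega
  have hC : C (l ++ [m]) = 2 * 4 ^ (l.sum + m) / (X l + 2 * m)! * B (l ++ [m]) := by
    rw [C, bgw, hexp, X_append_singleton, Nat.add_sub_cancel, pow_succ', pow_mul]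
    field_simp
    norm_num [mul_comm]
  rw [hC, normFactor]
  push_cast
  ring

/-- The normalized disconnected numbers. -/
noncomputable def nZ (m : ℕ) : Shuffle ℕ ℝ :=
  ⟨fun l => normFactor l.sum (X l) m * (Z (l ++ [m]) : ℝ)⟩

theorem nZ_apply (m : ℕ) (l : List ℕ) :
    nZ m l = normFactor l.sum (X l) m * (Z (l ++ [m]) : ℝ) := rfl

theorem raise_nZ (m d : ℕ) (l : List ℕ) :
    raise d (nZ m) l
      = normFactor (l.sum + d) (X l + 2 * d) m * ((raise d (rder m Z) l : ℚ) : ℝ) := by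
  simp only [raise_apply, Rat.cast_sum, Finset.mul_sum]
  refine Finset.sum_congr rfl fun i _ => ?_
  have hX := X_set l i d
  have hsum : (l.set i (l.get i + d)).sum = l.sum + d := by
    have h := X_eq_two_mul_sum_add_length l
    have h' := X_eq_two_mul_sum_add_length (l.set i (l.get i + d))
    rw [List.length_set] at h'
    omega
  rw [nZ_apply, hX, hsum, rder_apply]
  push_cast
  ring

theorem pairDer_nZ (m d : ℕ) (l : List ℕ) :
    4 * pairDer d (nZ m) l
      = normFactor (l.sum + d) (X l + 2 * d) m * ((pairDer d Z (l ++ [m]) : ℚ) : ℝ) := by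
  simp only [pairDer_apply, Rat.cast_sum, Finset.mul_sum]
  refine Finset.sum_congr rfl fun p hp => ?_
  have hp' := mem_pairs.mp hp
  have hX : X (p.1 :: p.2 :: l) = X l + 2 * d := by
    simp only [X_cons]
    omega
  have hsum : l.sum + d = (p.1 :: p.2 :: l).sum + 1 := by
    simp only [List.sum_cons]
    omega
  rw [nZ_apply, hX, hsum, normFactor_add_left, pow_one, mul_assoc]
  rfl

theorem nZ_cons (m d : ℕ) (l : List ℕ) :
    (2 * m + X l + 2 * d + 1) * nZ m (d :: l)
      = vir 2 (1 / 8) d (nZ m) l + (2 * m + 1) * nZ (m + d) l := by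
  have hcons : (2 * m + X l + 2 * d + 1) * nZ m (d :: l)
      = normFactor (l.sum + d) (X l + 2 * d) m * ((Z (d :: (l ++ [m])) : ℚ) : ℝ) := by
    rw [← mul_normFactor_succ, nZ_apply, X_cons, List.sum_cons, List.cons_append, add_comm d,
      show 2 * d + 1 + X l = X l + 2 * d + 1 by ring]
    push_cast
    ring
  have hdelta : (if d = 0 then (1 / 8 : ℝ) else 0) * nZ m l
      = normFactor (l.sum + d) (X l + 2 * d) m
        * (((if d = 0 then 1 / 8 else 0 : ℚ) * Z (l ++ [m]) : ℚ) : ℝ) := by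
    split_ifs with hd
    · rw [hd, mul_zero, add_zero, add_zero, nZ_apply]
      push_cast
      ring
    · simp
  have hpair := pairDer_nZ m d l
  rw [hcons, isVirasoro_Z.apply_cons, vir_apply, vir_apply, raise_append_singleton, raise_nZ,
    hdelta, nZ_apply, normFactor_add, ← rder_apply (m + d)]
  push_cast
  linear_combination (-1 / 2) * hpair

theorem nZ_nil (m : ℕ) : nZ m [] = Real.pi * gam (2 * m + 1) := by
  induction m with
  | zero =>
    have hgam : Real.Gamma (1 / 2 + 1) ^ 2 = Real.pi / 4 := by
      rw [Real.Gamma_add_one (by norm_num), Real.Gamma_one_half_eq, mul_pow,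
        Real.sq_sqrt Real.pi_pos.le]
      ring
    have hpi := Real.pi_ne_zero
    rw [nZ_apply, List.nil_append, Z_singleton_zero, normFactor, gam]
    simp only [X, List.map_nil, List.sum_nil, Nat.cast_zero, mul_zero, zero_add, hgam]
    field_simp
    norm_num [Nat.factorial]
  | succ m ih =>
    have hgam := gam_recurrence (x := 2 * m + 3) (by linarith [m.cast_nonneg (α := ℝ)])
    have hZ := congrArg (Rat.cast : ℚ → ℝ) (Z_singleton_succ m)
    have hfactor : (2 * (m : ℝ) + 2) * (2 * m + 1) * normFactor 0 0 (m + 1)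
        = 4 * normFactor 0 0 m := by
      rw [← pow_one (4 : ℝ), ← normFactor_add_left, normFactor_add, ← mul_normFactor_succ _ 0,
        ← mul_normFactor_succ _ (0 + 1)]
      push_cast
      ring
    rw [nZ_apply] at ih ⊢
    rw [show 2 * (m : ℝ) + 3 - 2 = 2 * m + 1 by ring] at hgam
    have hne : (2 * (m : ℝ) + 1) * ((2 * m + 3) ^ 2 - 1) ≠ 0 := by
      have : (0 : ℝ) < (2 * m + 3) ^ 2 - 1 := by nlinarith [m.cast_nonneg (α := ℝ)]
      positivity
    refine mul_left_cancel₀ hne ?_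
    simp only [List.sum_nil, show X [] = 0 from rfl, List.nil_append] at ih ⊢
    push_cast at hZ ⊢
    rw [show 2 * ((m : ℝ) + 1) + 1 = 2 * m + 3 by ring]
    linear_combination (2 * (m : ℝ) + 4) * (Z [m + 1] : ℝ) * hfactor
      + normFactor 0 0 m * hZ + (2 * (m : ℝ) + 1) * (2 * m + 3) ^ 2 * ih
      - Real.pi * (2 * (m : ℝ) + 1) * hgam

end Normalization

section Expansion

theorem hasInvFactExp_nZ (l : List ℕ) : HasInvFactExp (X l + 1) (fun m => nZ m l) (amp l) := by
  induction hn : X l using Nat.strong_induction_on generalizing l with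
  | _ n ih =>
  subst hn
  cases l with
  | nil => simpa [nZ_nil, amp_nil, show X [] = 0 from rfl] using hasInvFactExp_gam 1
  | cons d l =>
    have hX : X (d :: l) = X l + 2 * d + 1 := by
      rw [X_cons]
      ring
    have hraised : HasInvFactExp (X l + 2 * d + 1) (fun m => nZ (m + d) l) (amp l) := by
      have := (ih (X l) (by omega) l rfl).shift_arg d
      rwa [add_right_comm] at this
    have hvir := HasInvFactExp.vir 2 (1 / 8) (d := d) (l := l) (f := nZ) (g := amp) fun l' hl' =>
      hl' ▸ ih (X l') (by omega) l' rfl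
    have hbracket := hvir.add (hraised.const_mul (-((X l : ℚ) + 2 * d)))
    have hsum := hraised.shift_base.add (hbracket.invFact_mul 1)
    have hamp : amp (d :: l) = amp l + w * eulerDer (amp l)
        + w ^ 1 * (vir (PowerSeries.C 2) (PowerSeries.C (1 / 8)) d amp l
          + PowerSeries.C (-((X l : ℚ) + 2 * d)) * amp l) := by
      rw [amp_cons, map_ofNat]
      simp only [map_neg, map_add, map_mul, map_natCast, map_ofNat]
      ring
    rw [hX, hamp]
    refine hsum.congr' (Eventually.of_forall fun m => ?_)
    have hne : 2 * (m : ℝ) + X l + 2 * d + 1 ≠ 0 := by positivity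
    have hinv : invFact 1 (2 * m + (X l + 2 * d + 1 + 1 : ℕ))
        = (2 * (m : ℝ) + X l + 2 * d + 1)⁻¹ := by
      rw [invFact, Finset.prod_range_one]
      congr 1
      push_cast
      ring
    have hrec := nZ_cons m d l
    beta_reduce
    rw [hinv]
    push_cast
    field_simp
    linear_combination -hrec

theorem invFact_mul_normFactor (j s x m : ℕ) :
    invFact j (2 * m + (x + 1 + j : ℕ)) * normFactor s x m = normFactor s (x + j) m := by
  induction j with
  | zero => rw [invFact_zero, one_mul, add_zero]
  | succ j ih =>
    have hne : ((x + j : ℕ) : ℝ) + 1 + 2 * m ≠ 0 := by positivity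
    have hone : invFact 1 (2 * m + (x + 1 + (j + 1) : ℕ))
        = (((x + j : ℕ) : ℝ) + 1 + 2 * m)⁻¹ := by
      rw [invFact, Finset.prod_range_one]
      congr 1
      push_cast
      ring
    rw [add_comm j 1, invFact_add, add_comm 1 j, hone, Nat.cast_one, ← add_assoc (x + 1) j,
      Nat.cast_succ, ← add_assoc, add_sub_cancel_right, mul_assoc, ih, ← mul_normFactor_succ,
      inv_mul_cancel_left₀ hne, add_assoc]

theorem hasInvFactExp_mul {x s : ℕ} {f : ℕ → Shuffle ℕ ℚ} {g : Shuffle ℕ ℚ⟦X⟧} (q : Shuffle ℕ ℚ)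
    (l : List ℕ)
    (H : ∀ l, HasInvFactExp (x + X l + 1)
      (fun m => normFactor (s + l.sum) (x + X l) m * (f m l : ℝ)) (g l)) :
    HasInvFactExp (x + X l + 1)
      (fun m => normFactor (s + l.sum) (x + X l) m * (((f m * q) l : ℚ) : ℝ))
      ((g * twist timeWeight
        (Shuffle.map (PowerSeries.C : ℚ →+* ℚ⟦X⟧).toAddMonoidHom q)) l) := by
  induction l generalizing x s f g q with
  | nil =>
    have hnil := (H []).const_mul (q [])
    rw [mul_nil, twist_nil, map_apply, mul_comm]
    refine hnil.congr' (Eventually.of_forall fun m => ?_)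
    simp only [mul_nil]
    push_cast
    ring
  | cons d l ih =>
    have hX : x + X (d :: l) = x + (2 * d + 1) + X l := by
      rw [X_cons]
      ring
    have hsum : s + (d :: l).sum = s + d + l.sum := by rw [List.sum_cons, add_assoc]
    have hleft := ih (x := x + (2 * d + 1)) (s := s + d) (f := fun m => der d (f m))
      (g := der d g) q fun l => by
        simpa only [X_cons, List.sum_cons, ← add_assoc, der_apply] using H (d :: l)
    have hright := ((ih (der d q) H).invFact_mul (2 * d + 1)).const_mul (4 ^ d)
    have hbase : x + X l + 1 + (2 * d + 1) = x + (2 * d + 1) + X l + 1 := by ring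
    have hseries : PowerSeries.C (4 ^ d) * (w ^ (2 * d + 1) * (g * twist timeWeight
          (Shuffle.map (PowerSeries.C : ℚ →+* ℚ⟦X⟧).toAddMonoidHom (der d q))) l)
        = (g * der d (twist timeWeight
          (Shuffle.map (PowerSeries.C : ℚ →+* ℚ⟦X⟧).toAddMonoidHom q))) l := by
      rw [der_twist, mul_smul_comm, Shuffle.smul_apply, timeWeight, mul_assoc]
      rfl
    rw [hseries, hbase] at hright
    rw [mul_cons, hX, hsum]
    refine (hleft.add hright).congr' (Eventually.of_forall fun m => ?_)
    have hfactor := invFact_mul_normFactor (2 * d + 1) (s + l.sum) (x + X l) m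
    rw [hbase, show x + X l + (2 * d + 1) = x + (2 * d + 1) + X l by ring] at hfactor
    simp only [mul_cons, add_right_comm s d, normFactor_add_left _ d]
    rw [← hfactor]
    push_cast
    ring

theorem hasInvFactExp_C (l : List ℕ) :
    HasInvFactExp (X l + 1) (fun m => Real.pi * (C (l ++ [m]) : ℝ)) (subsum connSeries l) := by
  have hmul := hasInvFactExp_mul (x := 0) (s := 0) (f := fun m => rder m Z) (g := amp) Zinv l
    fun l => by
      simp only [zero_add]
      exact hasInvFactExp_nZ l
  simp only [zero_add, amp, subsum, mul_assoc, ← connSeries.eq_1, ← rder_conn] at hmul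
  refine hmul.congr' (Eventually.of_forall fun m => ?_)
  simp only [C_append_singleton]
  rfl

end Expansion

/-! ### Expansion in powers of the inverse argument -/

section PowerExpansion

/-- The asymptotic expansion `h ~ ∑ aₖ tᵏ`, in powers of the null sequence `t`. -/
def HasPowExp (t h : ℕ → ℝ) (a : ℚ⟦X⟧) : Prop :=
  ∀ L : ℕ, (fun m => h m - ∑ k ∈ Finset.range L, ((coeff k a : ℚ) : ℝ) * t m ^ k)
    =O[atTop] fun m => t m ^ L

variable {t h h' : ℕ → ℝ} {a a' : ℚ⟦X⟧}

theorem aeval_trunc (L : ℕ) (a : ℚ⟦X⟧) (x : ℝ) :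
    Polynomial.aeval x (trunc L a) = ∑ k ∈ Finset.range L, ((coeff k a : ℚ) : ℝ) * x ^ k := by
  rw [Polynomial.aeval_def, eval₂_trunc_eq_sum_range]
  rfl

theorem aeval_isBigO_one (ht : Tendsto t atTop (nhds 0)) (p : Polynomial ℚ) :
    (fun m => Polynomial.aeval (t m) p) =O[atTop] fun _ => (1 : ℝ) :=
  (((Polynomial.continuous_aeval p).tendsto 0).comp ht).isBigO_one ℝ

theorem aeval_isBigO_pow (ht : Tendsto t atTop (nhds 0)) {p : Polynomial ℚ} {L : ℕ}
    (hp : ∀ k < L, p.coeff k = 0) :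
    (fun m => Polynomial.aeval (t m) p) =O[atTop] fun m => t m ^ L := by
  obtain ⟨q, rfl⟩ := Polynomial.X_pow_dvd_iff.mpr hp
  simpa using (isBigO_refl (fun m => t m ^ L) atTop).mul (aeval_isBigO_one ht q)

theorem coeff_trunc_sub_eq_zero {p : Polynomial ℚ} {L : ℕ}
    (hp : ∀ k < L, p.coeff k = coeff k a) : ∀ k < L, (p - trunc L a).coeff k = 0 := by
  intro k hk
  rw [Polynomial.coeff_sub, coeff_trunc, if_pos hk, hp k hk, sub_self]

theorem hasPowExp_aeval (ht : Tendsto t atTop (nhds 0)) (p : Polynomial ℚ) :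
    HasPowExp t (fun m => Polynomial.aeval (t m) p) (p : ℚ⟦X⟧) := fun L => by
  have htail := aeval_isBigO_pow ht (coeff_trunc_sub_eq_zero (p := p) (L := L)
    fun k _ => (Polynomial.coeff_coe p k).symm)
  exact htail.congr_left fun m => by rw [map_sub, aeval_trunc]

namespace HasPowExp

theorem congr' (H : HasPowExp t h a) (e : h =ᶠ[atTop] h') : HasPowExp t h' a := fun L =>
  (H L).congr' (e.sub EventuallyEq.rfl) EventuallyEq.rfl

theorem isBigO_one (H : HasPowExp t h a) : h =O[atTop] fun _ => (1 : ℝ) := by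
  simpa using H 0

theorem mul (ht : Tendsto t atTop (nhds 0)) (H : HasPowExp t h a) (H' : HasPowExp t h' a') :
    HasPowExp t (fun m => h m * h' m) (a * a') := fun L => by
  have hleft := (H L).mul H'.isBigO_one
  have hright := (aeval_isBigO_one ht (trunc L a)).mul (H' L)
  have htail := aeval_isBigO_pow ht (coeff_trunc_sub_eq_zero (p := trunc L a * trunc L a')
    (a := a * a') (L := L) fun k hk => by
      rw [coeff_mul_eq_coeff_trunc_mul_trunc a a' hk, ← Polynomial.coe_mul, Polynomial.coeff_coe])
  simp only [mul_one, one_mul] at hleft hright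
  refine ((hleft.add hright).add htail).congr_left fun m => ?_
  simp only [map_sub, map_mul, aeval_trunc]
  ring

theorem tendsto (ht : Tendsto t atTop (nhds 0)) (H : HasPowExp t h a) :
    Tendsto h atTop (nhds ((constantCoeff a : ℚ) : ℝ)) := by
  have hfirst := H 1
  simp only [Finset.sum_range_one, pow_zero, mul_one, pow_one,
    coeff_zero_eq_constantCoeff] at hfirst
  simpa using (hfirst.trans_tendsto ht).add_const ((constantCoeff a : ℚ) : ℝ)

theorem inv (ht : Tendsto t atTop (nhds 0)) (H : HasPowExp t h a) (ha : constantCoeff a ≠ 0) :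
    HasPowExp t (fun m => (h m)⁻¹) a⁻¹ := fun L => by
  have hc : ((constantCoeff a : ℚ) : ℝ) ≠ 0 := Rat.cast_ne_zero.mpr ha
  have hlim := H.tendsto ht
  have htail := aeval_isBigO_pow ht (coeff_trunc_sub_eq_zero (p := trunc L a * trunc L a⁻¹)
    (a := 1) (L := L) fun k hk => by
      rw [← PowerSeries.mul_inv_cancel a ha, coeff_mul_eq_coeff_trunc_mul_trunc a _ hk,
        ← Polynomial.coe_mul, Polynomial.coeff_coe])
  have hprod := (H L).mul (aeval_isBigO_one ht (trunc L a⁻¹))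
  simp only [mul_one] at hprod
  have hone : (fun m => 1 - Polynomial.aeval (t m) (trunc L (1 : ℚ⟦X⟧))) =O[atTop]
      fun m => t m ^ L := by
    simpa only [aeval_trunc, map_one, Polynomial.coe_one]
      using hasPowExp_aeval ht 1 L
  have hdefect := ((hlim.inv₀ hc).isBigO_one ℝ).mul ((hone.sub hprod).sub htail)
  simp only [one_mul] at hdefect
  refine hdefect.congr' ?_ EventuallyEq.rfl
  filter_upwards [hlim.eventually_ne hc] with m hm
  simp only [map_sub, map_mul, aeval_trunc]
  field_simp
  ring

end HasPowExp

end PowerExpansion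

section Conversion

/-- The power series in `x⁻¹` of the inverse factorial `invFact k x`. -/
noncomputable def invFactSeries (k : ℕ) : ℚ⟦X⟧ :=
  ∏ i ∈ Finset.range k,
    (w * ((1 - Polynomial.C ((i : ℚ) + 1) * Polynomial.X : Polynomial ℚ) : ℚ⟦X⟧)⁻¹)

theorem X_pow_dvd_invFactSeries (k : ℕ) : w ^ k ∣ invFactSeries k := by
  rw [invFactSeries, Finset.prod_mul_distrib, Finset.prod_const, Finset.card_range]
  exact dvd_mul_right _ _

theorem tendsto_inv_two_mul_add (x₀ : ℕ) :
    Tendsto (fun m : ℕ => (2 * (m : ℝ) + x₀)⁻¹) atTop (nhds 0) :=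
  (inv_affine_isTheta two_ne_zero (x₀ : ℝ)).isBigO.trans_tendsto
    tendsto_inv_atTop_nhds_zero_nat

theorem hasPowExp_invFact (x₀ k : ℕ) :
    HasPowExp (fun m : ℕ => (2 * (m : ℝ) + x₀)⁻¹) (fun m => invFact k (2 * m + x₀))
      (invFactSeries k) := by
  have ht := tendsto_inv_two_mul_add x₀
  induction k with
  | zero => simpa [invFactSeries] using hasPowExp_aeval ht 1
  | succ k ih =>
    have hlinear := (hasPowExp_aeval ht (1 - Polynomial.C ((k : ℚ) + 1) * Polynomial.X)).inv ht (by
      rw [← coeff_zero_eq_constantCoeff, Polynomial.coeff_coe]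
      simp)
    have hprod := ih.mul ht ((hasPowExp_aeval ht Polynomial.X).mul ht hlinear)
    rw [invFactSeries, Finset.prod_range_succ, ← invFactSeries, ← Polynomial.coe_X]
    refine hprod.congr' ?_
    filter_upwards [eventually_gt_atTop 0] with m hm
    have hx : 2 * (m : ℝ) + x₀ ≠ 0 := by positivity
    rw [invFact_succ]
    simp only [map_sub, map_mul, map_one, Polynomial.aeval_X, Polynomial.aeval_C]
    rw [← mul_inv]
    congr 2
    simp only [map_add, map_natCast, map_one]
    field_simp

/-- Conversion of the coefficients of an inverse factorial expansion in `x` into those of its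
expansion in powers of `x⁻¹`. The sum can stop at `j = k`, since `invFactSeries j` is divisible
by `X ^ j`. -/
noncomputable def toPow : ℚ⟦X⟧ →+ ℚ⟦X⟧ where
  toFun g := PowerSeries.mk fun k =>
    ∑ j ∈ Finset.range (k + 1), coeff j g * coeff k (invFactSeries j)
  map_zero' := by
    ext k
    simp
  map_add' g g' := by
    ext k
    simp [add_mul, Finset.sum_add_distrib]

theorem coeff_toPow (g : ℚ⟦X⟧) {k n : ℕ} (h : k < n) :
    coeff k (toPow g) = ∑ j ∈ Finset.range n, coeff j g * coeff k (invFactSeries j) := by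
  have hdef : coeff k (toPow g)
      = ∑ j ∈ Finset.range (k + 1), coeff j g * coeff k (invFactSeries j) := by
    simp [toPow]
  rw [hdef]
  refine Finset.sum_subset (Finset.range_subset_range.mpr h) fun j _ hj => ?_
  rw [Finset.mem_range, not_lt] at hj
  rw [X_pow_dvd_iff.mp (X_pow_dvd_invFactSeries j) k hj, mul_zero]

theorem X_pow_dvd_toPow {g : ℚ⟦X⟧} {n : ℕ} (h : w ^ n ∣ g) : w ^ n ∣ toPow g := by
  rw [X_pow_dvd_iff] at h ⊢
  intro k hk
  rw [coeff_toPow g (Nat.lt_succ_self k)]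
  refine Finset.sum_eq_zero fun j hj => ?_
  rw [h j ((Finset.mem_range_succ_iff.mp hj).trans_lt hk), zero_mul]

theorem constantCoeff_toPow (g : ℚ⟦X⟧) : constantCoeff (toPow g) = constantCoeff g := by
  rw [← coeff_zero_eq_constantCoeff, coeff_toPow g Nat.zero_lt_one]
  simp [invFactSeries]

theorem sum_coeff_toPow_mul_pow (g : ℚ⟦X⟧) (L : ℕ) (x : ℝ) :
    ∑ k ∈ Finset.range L, ((coeff k (toPow g) : ℚ) : ℝ) * x ^ k
      = ∑ j ∈ Finset.range L, ((coeff j g : ℚ) : ℝ)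
        * ∑ k ∈ Finset.range L, ((coeff k (invFactSeries j) : ℚ) : ℝ) * x ^ k := by
  simp only [Finset.mul_sum]
  rw [Finset.sum_comm]
  refine Finset.sum_congr rfl fun k hk => ?_
  rw [coeff_toPow g (Finset.mem_range.mp hk)]
  push_cast
  simp only [Finset.sum_mul, mul_assoc]

theorem HasInvFactExp.hasPowExp {x₀ : ℕ} {h : ℕ → ℝ} {g : ℚ⟦X⟧} (H : HasInvFactExp x₀ h g) :
    HasPowExp (fun m : ℕ => (2 * (m : ℝ) + x₀)⁻¹) h (toPow g) := fun L => by
  have hremainder := (H L).trans ((inv_affine_isTheta two_ne_zero (x₀ : ℝ)).pow L).isBigO_symm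
  have hterms := IsBigO.fun_sum fun j (_ : j ∈ Finset.range L) =>
    (hasPowExp_invFact x₀ j L).const_mul_left ((coeff j g : ℚ) : ℝ)
  refine (hremainder.add hterms).congr_left fun m => ?_
  rw [sum_coeff_toPow_mul_pow, invFactSum]
  simp only [mul_sub, Finset.sum_sub_distrib]
  ring

end Conversion

section RelativeConnected

theorem constantCoeff_toPow_S_nil : constantCoeff (toPow (S [])) = 1 := by
  rw [constantCoeff_toPow, ← coeff_zero_eq_constantCoeff_apply, coeff_zero_S_nil]

/-- The contribution of a family of insertions to the expansion of `Chat` in powers of `X⁻¹`: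
the connected series, converted to powers and divided by the expansion of `π γ`. -/
noncomputable def relConn : Shuffle ℕ ℚ⟦X⟧ :=
  Shuffle.map ((AddMonoidHom.mulRight (toPow (S []))⁻¹).comp toPow) connSeries

theorem relConn_apply (l : List ℕ) : relConn l = toPow (connSeries l) * (toPow (S []))⁻¹ := rfl

theorem relConn_nil : relConn [] = 1 := by
  rw [relConn_apply, connSeries_nil, PowerSeries.mul_inv_cancel]
  rw [constantCoeff_toPow_S_nil]
  exact one_ne_zero

theorem symmetric_relConn : Symmetric relConn := symmetric_connSeries.map _

theorem X_pow_dvd_relConn {l : List ℕ} (hl : l ≠ []) : w ^ (X l + 1) ∣ relConn l :=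
  (X_pow_dvd_toPow (X_pow_dvd_connSeries hl)).mul_right _

theorem coeff_relConn_eq_zero {k : ℕ} {l : List ℕ} (h : k - 1 < X l) :
    coeff k (relConn l) = 0 := by
  refine X_pow_dvd_iff.mp (X_pow_dvd_relConn ?_) k (by omega)
  rintro rfl
  simp [X] at h

theorem hasPowExp_Chat (l : List ℕ) :
    HasPowExp (fun m => (X (l ++ [m]) : ℝ)⁻¹) (fun m => Chat (l ++ [m])) (subsum relConn l) := by
  have ht := tendsto_inv_two_mul_add (X l + 1)
  have hC := (hasInvFactExp_C l).hasPowExp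
  have hgam := (hasInvFactExp_gam (X l + 1)).hasPowExp.inv ht (by
    rw [constantCoeff_toPow_S_nil]
    exact one_ne_zero)
  have hX : ∀ m : ℕ, (X (l ++ [m]) : ℝ) = 2 * m + (X l + 1 : ℕ) := fun m => by
    rw [X_append_singleton]
    push_cast
    ring
  simp only [hX, relConn, ← map_subsum]
  refine (hC.mul ht hgam).congr' (Eventually.of_forall fun m => ?_)
  beta_reduce
  rw [Chat, hX, ← div_eq_mul_inv, mul_div_mul_left _ _ Real.pi_ne_zero]

end RelativeConnected

/-! ### Polynomiality in the multiplicities -/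

namespace Shuffle

section Subsum

variable {α K : Type*} [CommRing K]

theorem der_pow_apply (a : α) (j : ℕ) (f : Shuffle α K) (l : List α) :
    (der a ^ j) f l = f (List.replicate j a ++ l) := by
  induction j generalizing l with
  | zero => rfl
  | succ j ih =>
    rw [pow_succ', Module.End.mul_apply, der_apply, ih, List.replicate_succ', List.append_assoc]
    rfl

theorem Symmetric.der_pow {f : Shuffle α K} (hf : Symmetric f) (a : α) (j : ℕ) :
    Symmetric ((Shuffle.der a ^ j) f) := fun l l' h => by
  rw [der_pow_apply, der_pow_apply]
  exact hf _ _ (h.append_left _)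

theorem subsum_replicate_append (a : α) (n : ℕ) (f : Shuffle α K) (l : List α) :
    subsum f (List.replicate n a ++ l) = subsum (((der a + 1) ^ n) f) l := by
  induction n generalizing f with
  | zero => rfl
  | succ n ih =>
    rw [List.replicate_succ, List.cons_append, subsum_cons, ih, ih, pow_succ,
      Module.End.mul_apply, LinearMap.add_apply, Module.End.one_apply, _root_.map_add, subsum,
      subsum, subsum, mul_add, Shuffle.add_apply, add_comm]

theorem subsum_eq_sum_choose [DecidableEq α] {f : Shuffle α K} (hf : Symmetric f) {a : α} {J : ℕ}
    (hJ : ∀ j, J ≤ j → (der a ^ j) f = 0) (l : List α) :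
    subsum f l = ∑ j ∈ Finset.range J,
      ((l.count a).choose j : K) * subsum ((der a ^ j) f) (l.filter (· ≠ a)) := by
  have hperm : l.Perm (List.replicate (l.count a) a ++ l.filter (· ≠ a)) := by
    rw [← List.filter_eq]
    simpa using (List.filter_append_perm (· = a) l).symm
  have hsymm : Symmetric (subsum f) := Symmetric.mul (fun _ _ _ => rfl) hf
  rw [hsymm _ _ hperm, subsum_replicate_append, (Commute.one_right _).add_pow]
  simp only [one_pow, mul_one, LinearMap.sum_apply, Module.End.mul_apply,
    Module.End.natCast_apply, ← Nat.cast_smul_eq_nsmul K, _root_.map_smul, subsum, Finset.mul_sum,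
    mul_smul_comm, sum_apply, smul_apply]
  refine Finset.sum_congr_of_eq_on_inter (fun j _ hj => ?_) (fun j _ hj => ?_) fun _ _ _ => rfl
  · rw [hJ j (not_lt.mp fun h => hj (Finset.mem_range.mpr h)), mul_zero, zero_apply, mul_zero]
  · rw [Nat.choose_eq_zero_of_lt (not_le.mp fun h => hj (Finset.mem_range_succ_iff.mpr h)),
      Nat.cast_zero, zero_mul]

theorem subsum_eq_apply_nil {f : Shuffle α K} {l : List α}
    (h : ∀ l', l'.Sublist l → l' ≠ [] → f l' = 0) : subsum f l = f [] := by
  have hagree : ∀ l', l'.Sublist l → f l' = (f [] • (1 : Shuffle α K)) l' := fun l' hl' => by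
    cases l' with
    | nil => simp
    | cons a l' => simp [h _ hl']
  rw [subsum, mul_apply_congr (fun _ _ => rfl) hagree, mul_smul_comm, mul_one, smul_apply,
    ones_apply, mul_one]

end Subsum

end Shuffle

section WeightedDegree

open MvPolynomial

variable {σ R M : Type*} [CommSemiring R] [AddCommMonoid M] [SemilatticeSup M] [OrderBot M]

theorem weightedTotalDegree_monomial_le (u : σ → M) (s : σ →₀ ℕ) (r : R) :
    weightedTotalDegree u (monomial s r) ≤ Finsupp.weight u s :=
  Finset.sup_le fun _ ht => (Finset.mem_singleton.mp (support_monomial_subset ht) ▸ le_rfl)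

theorem weightedTotalDegree_sum_le {ι : Type*} (u : σ → M) {N : M} (s : Finset ι)
    (p : ι → MvPolynomial σ R) (hp : ∀ i ∈ s, weightedTotalDegree u (p i) ≤ N) :
    weightedTotalDegree u (∑ i ∈ s, p i) ≤ N := by
  classical
  refine Finset.sup_le fun t ht => ?_
  obtain ⟨i, hi, hti⟩ := Finset.mem_biUnion.mp (support_sum ht)
  exact (le_weightedTotalDegree u hti).trans (hp i hi)

theorem weightedTotalDegree_mul_le [AddLeftMono M] (u : σ → M) (p q : MvPolynomial σ R) :
    weightedTotalDegree u (p * q) ≤ weightedTotalDegree u p + weightedTotalDegree u q := by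
  classical
  refine Finset.sup_le fun s hs => ?_
  obtain ⟨a, ha, b, hb, rfl⟩ := Finset.mem_add.mp (support_mul p q hs)
  rw [map_add]
  exact add_le_add (le_weightedTotalDegree u ha) (le_weightedTotalDegree u hb)

theorem weightedTotalDegree_aeval_X_le (u : σ → ℕ) (i : σ) (p : Polynomial R) :
    weightedTotalDegree u (Polynomial.aeval (MvPolynomial.X i : MvPolynomial σ R) p) ≤
      p.natDegree * u i := by
  rw [Polynomial.aeval_eq_sum_range]
  refine weightedTotalDegree_sum_le u _ _ fun k hk => ?_
  rw [X_pow_eq_monomial, smul_monomial]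
  refine (weightedTotalDegree_monomial_le u _ _).trans ?_
  rw [Finsupp.weight_single, smul_eq_mul]
  exact Nat.mul_le_mul_right _ (Finset.mem_range_succ_iff.mp hk)

/-- The polynomial `binom(p_b, j)` in the variable `p_b`. -/
noncomputable def binomPoly (b : σ) (j : ℕ) : MvPolynomial σ ℚ :=
  Polynomial.aeval (MvPolynomial.X b) (Polynomial.C (j ! : ℚ)⁻¹ * descPochhammer ℚ j)

theorem weightedTotalDegree_binomPoly_le (u : σ → ℕ) (b : σ) (j : ℕ) :
    weightedTotalDegree u (binomPoly b j) ≤ j * u b := by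
  refine (weightedTotalDegree_aeval_X_le u b _).trans (Nat.mul_le_mul_right _ ?_)
  exact (Polynomial.natDegree_C_mul_le _ _).trans (descPochhammer_natDegree ℚ j).le

theorem eval_binomPoly {g : σ → ℚ} {b : σ} {n : ℕ} (hg : g b = n) (j : ℕ) :
    eval g (binomPoly b j) = n.choose j := by
  rw [binomPoly, ← aeval_eq_eval, ← Polynomial.aeval_algHom_apply, aeval_X, hg,
    Polynomial.coe_aeval_eq_eval, Polynomial.eval_C_mul, Nat.cast_choose_eq_descPochhammer_div,
    div_eq_inv_mul]

end WeightedDegree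

section Multiplicities

open MvPolynomial

theorem X_replicate_append (j b : ℕ) (l : List ℕ) :
    X (List.replicate j b ++ l) = j * (2 * b + 1) + X l := by
  simp [X]

theorem mult_filter_ne {l : List ℕ} {b : ℕ} {r : ℕ+} (h : (r : ℕ) ≠ b) :
    mult (l.filter (· ≠ b)) r = mult l r := by
  rw [mult, mult, List.count_filter (by simpa using h)]

/-- The polynomial `p` computes the sums of `f` over subfamilies of words with all entries at
least `b`. The variables `p_r` with `r < b` are left unconstrained: they are eliminated one at a
time. -/
def ComputesSubsum (f : Shuffle ℕ ℚ) (b : ℕ+) (p : MvPolynomial ℕ+ ℚ) : Prop :=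
  ∀ (l : List ℕ) (g : ℕ+ → ℚ), (∀ d ∈ l, (b : ℕ) ≤ d) → (∀ r, b ≤ r → g r = mult l r) →
    eval g p = subsum f l

theorem computesSubsum_C {f : Shuffle ℕ ℚ} {b : ℕ+} {N : ℕ} (hb : N < 2 * b + 1)
    (hN : ∀ l, N < X l → f l = 0) : ComputesSubsum f b (MvPolynomial.C (f [])) := fun l g hl _ => by
  rw [eval_C, subsum_eq_apply_nil fun l' hl' hne => hN l' ?_]
  cases l' with
  | nil => exact absurd rfl hne
  | cons d l' =>
    have hd := hl d (hl'.subset List.mem_cons_self)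
    rw [X_cons]
    omega

theorem ComputesSubsum.sum_binomPoly {f : Shuffle ℕ ℚ} (hf : Symmetric f) {b : ℕ+} {J : ℕ}
    (hJ : ∀ j, J ≤ j → (der (b : ℕ) ^ j) f = 0) {p : ℕ → MvPolynomial ℕ+ ℚ}
    (hp : ∀ j, ComputesSubsum ((der (b : ℕ) ^ j) f) (b + 1) (p j)) :
    ComputesSubsum f b (∑ j ∈ Finset.range J, binomPoly b j * p j) := fun l g hl hg => by
  rw [subsum_eq_sum_choose hf hJ, map_sum]
  refine Finset.sum_congr rfl fun j _ => ?_
  have hentries : ∀ d ∈ l.filter (· ≠ (b : ℕ)), ((b + 1 : ℕ+) : ℕ) ≤ d := fun d hd => by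
    obtain ⟨hdl, hdb⟩ := List.mem_filter.mp hd
    exact lt_of_le_of_ne (hl d hdl) (Ne.symm (of_decide_eq_true hdb))
  have hmult : ∀ r, b + 1 ≤ r → g r = mult (l.filter (· ≠ (b : ℕ))) r := fun r hr => by
    have hbr := PNat.add_one_le_iff.mp hr
    rw [hg r hbr.le, mult_filter_ne (PNat.coe_lt_coe _ _ |>.mpr hbr).ne']
  rw [map_mul, eval_binomPoly (hg b le_rfl), hp j _ g hentries hmult]

theorem exists_computesSubsum {f : Shuffle ℕ ℚ} (hf : Symmetric f) {N : ℕ}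
    (hN : ∀ l, N < X l → f l = 0) (b : ℕ+) :
    ∃ p : MvPolynomial ℕ+ ℚ,
      weightedTotalDegree (fun d : ℕ+ => 2 * (d : ℕ) + 1) p ≤ N ∧ ComputesSubsum f b p := by
  obtain ⟨k, hk⟩ : ∃ k, N < 2 * (b + k) + 1 := ⟨N, by omega⟩
  induction k generalizing f N b with
  | zero =>
    refine ⟨MvPolynomial.C (f []), ?_, computesSubsum_C hk hN⟩
    exact (weightedTotalDegree_monomial_le _ 0 _).trans (by simp)
  | succ k ih =>
    set x := 2 * (b : ℕ) + 1
    have hx : 0 < x := Nat.succ_pos _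
    have hder : ∀ j l, N < j * x + X l → (der (b : ℕ) ^ j) f l = 0 := fun j l hl => by
      rw [der_pow_apply]
      exact hN _ (by rwa [X_replicate_append])
    have hJ : ∀ j, N / x + 1 ≤ j → (der (b : ℕ) ^ j) f = 0 := fun j hj => ext fun l =>
      hder j l (((Nat.div_lt_iff_lt_mul hx).mp hj).trans_le (Nat.le_add_right _ _))
    have hstep : ∀ j, ∃ p : MvPolynomial ℕ+ ℚ,
        weightedTotalDegree (fun d : ℕ+ => 2 * (d : ℕ) + 1) p ≤ N - j * x
          ∧ ComputesSubsum ((der (b : ℕ) ^ j) f) (b + 1) p := fun j =>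
      ih (hf.der_pow b j) (fun l hl => hder j l (by omega)) (b + 1)
        (by rw [PNat.add_coe, PNat.one_coe]; omega)
    choose p hdeg hp using hstep
    refine ⟨_, weightedTotalDegree_sum_le _ _ _ fun j hj => ?_, .sum_binomPoly hf hJ hp⟩
    have hjx : j * x ≤ N :=
      (Nat.le_div_iff_mul_le hx).mp (Finset.mem_range_succ_iff.mp hj)
    refine (weightedTotalDegree_mul_le _ _ _).trans ?_
    exact (add_le_add (weightedTotalDegree_binomPoly_le _ b j) (hdeg j)).trans
      (Nat.add_sub_of_le hjx).le

theorem exists_polynomial_coeff_subsum_relConn (k : ℕ) :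
    ∃ p : MvPolynomial ℕ+ ℚ,
      weightedTotalDegree (fun d : ℕ+ => 2 * (d : ℕ) + 1) p ≤ k - 1 ∧
      ∀ l : List ℕ, (∀ d ∈ l, 1 ≤ d) →
        eval (mult l) p = PowerSeries.coeff k (subsum relConn l) := by
  let coeffHom := (PowerSeries.coeff (R := ℚ) k).toAddMonoidHom
  obtain ⟨p, hdeg, hp⟩ := exists_computesSubsum (f := Shuffle.map coeffHom relConn)
    (symmetric_relConn.map coeffHom) (fun l hl => coeff_relConn_eq_zero hl) 1
  refine ⟨p, hdeg, fun l hl => ?_⟩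
  rw [hp l _ hl fun _ _ => rfl, ← map_subsum]
  rfl

theorem coeff_zero_subsum_relConn (l : List ℕ) :
    PowerSeries.coeff 0 (subsum relConn l) = 1 := by
  let coeffHom := (PowerSeries.coeff (R := ℚ) 0).toAddMonoidHom
  have hvanish : ∀ l' : List ℕ, l' ≠ [] → Shuffle.map coeffHom relConn l' = 0 := fun l' hl' => by
    obtain ⟨d, l', rfl⟩ := List.exists_cons_of_ne_nil hl'
    exact coeff_relConn_eq_zero (by rw [X_cons]; omega)
  have hsum := DFunLike.congr_fun (map_subsum coeffHom relConn) l
  rw [subsum_eq_apply_nil fun l' _ => hvanish l', map_apply, map_apply, relConn_nil] at hsum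
  exact hsum.trans PowerSeries.coeff_zero_one

theorem exists_polynomials_coeff_subsum_relConn :
    ∃ c : ℕ → MvPolynomial ℕ+ ℚ, c 0 = 1 ∧
      (∀ k, weightedTotalDegree (fun d : ℕ+ => 2 * (d : ℕ) + 1) (c k) ≤ k - 1) ∧
      ∀ k (l : List ℕ), (∀ d ∈ l, 1 ≤ d) →
        eval (mult l) (c k) = PowerSeries.coeff k (subsum relConn l) := by
  choose p hdeg heval using exists_polynomial_coeff_subsum_relConn
  refine ⟨Function.update p 0 1, Function.update_self .., fun k => ?_, fun k l hl => ?_⟩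
  all_goals rcases eq_or_ne k 0 with rfl | hk
  · rw [Function.update_self]
    exact (weightedTotalDegree_monomial_le _ 0 _).trans (by simp)
  · rw [Function.update_of_ne hk]
    exact hdeg k
  · rw [Function.update_self, map_one, coeff_zero_subsum_relConn]
  · rw [Function.update_of_ne hk, heval k l hl]

end Multiplicities

end BGW

theorem theorem1p2 :
    ∃ c : ℕ → MvPolynomial ℕ+ ℚ,
      c 0 = 1 ∧
      (∀ k, 1 ≤ k → MvPolynomial.eval (fun _ => (0 : ℚ)) (c k) = 0) ∧
      (∀ k, 1 ≤ k →
        MvPolynomial.weightedTotalDegree (fun d : ℕ+ => 2 * (d : ℕ) + 1) (c k) ≤ k - 1) ∧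
      ∀ d' : List ℕ, (∀ d ∈ d', 1 ≤ d) → ∀ L : ℕ,
        (fun m : ℕ => BGW.Chat (d' ++ [m])
            - ∑ k ∈ Finset.range L,
                ((MvPolynomial.eval (BGW.mult d') (c k) : ℚ) : ℝ) / (BGW.X (d' ++ [m]) : ℝ) ^ k)
          =O[atTop] fun m : ℕ => 1 / (BGW.X (d' ++ [m]) : ℝ) ^ L := by
  obtain ⟨c, hzero, hdeg, heval⟩ := BGW.exists_polynomials_coeff_subsum_relConn
  refine ⟨c, hzero, fun k hk => ?_, fun k _ => hdeg k, fun l hl L => ?_⟩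
  · have hmult : BGW.mult [] = fun _ => (0 : ℚ) := funext fun r => by simp [BGW.mult]
    rw [← hmult, heval k [] (by simp), BGW.Shuffle.subsum_nil, BGW.relConn_nil,
      PowerSeries.coeff_one, if_neg (by omega)]
  · have hexp := BGW.hasPowExp_Chat l L
    simpa only [heval _ l hl, inv_pow, div_eq_mul_inv, one_mul] using hexp
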